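/- **Theorem (Policy evaluation error of neural PPO).** *Setting.* Let $\mathcal S$ be a measurable (e.g. compact) state space, $\mathcal A$ a finite nonempty action space, $\mathcal P(\cdot\,|\,s,a)$ a transition kernel, $r:\mathcal S\times\mathcal A\to\mathbb R$ a measurable reward and $\gamma\in(0,1)$. Every pair $(s,a)$ is identified (measurably) with a vector of $\mathbb R^d$, $d\ge 3$, with $\|(s,a)\|_2\le 1$. A policy $\pi(\cdot\,|\,s)$ is a Markov kernel from $\mathcal S$ to $\mathcal A$, and $$Q^\pi(s,a)=(1-\gamma)\,\mathbb E\Big[\sum_{t\ge0}\gamma^t r(s_t,a_t)\,\Big|\,s_0=s,\,a_0=a,\,s_{t+1}\sim\mathcal P(\cdot\,|\,s_t,a_t),\,a_{t+1}\sim\pi(\cdot\,|\,s_{t+1})\Big].$$ Every policy $\pi$ has a stationary state distribution $\nu_\pi$, and $\sigma_\pi(s,a)=\pi(a\,|\,s)\,\nu_\pi(s)$. *Networks.* For input weights $\alpha=([\alpha]_1,\dots,[\alpha]_m)\in\mathbb R^{md}$ with the Euclidean norm, and output weights $b\in\{-1,1\}^m$, $m\ge1$, let $u_\alpha(x)=m^{-1/2}\sum_{i=1}^m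 b_i\max\{[\alpha]_i^\top x,0\}$, and let $\nabla_\alpha u_\alpha(x)$ be the vector with blocks $m^{-1/2}b_i\mathbf 1\{[\alpha]_i^\top x>0\}\,x$. At initialization the $b_i\sim\mathrm{Unif}\{-1,1\}$ and $[\alpha(0)]_i\sim\mathcal N(0,I_d/d)$ are all independent. Let $\mathcal B^0(R)=\{\alpha:\|\alpha-\alpha(0)\|_2\le R\}$, let $\Pi_{\mathcal B^0(R)}$ be the Euclidean projection onto it, and let $$\mathcal F_{R,m}=\Big\{x\mapsto m^{-1/2}\sum_{i=1}^m b_i\mathbf 1\{[\alpha(0)]_i^\top x>0\}\,[\alpha]_i^\top x:\ \alpha\in\mathcal B^0(R)\Big\},$$ a class that depends on the initialization. *Algorithm (neural PPO).* Let $K,T\in\mathbb N$, $\beta>0$, $R_f\ge R_Q>0$, $\eta=T^{-1/2}$, $\tau_0=1$, $\tau_{k+1}=\beta\sqrt K/(k+1)$, $\beta_k=\beta\sqrt K$. The actor $f$ and the critic $Q$ have the same width $m=m_f=m_Q$ and share one initialization $(\alpha(0),b)$, drawn once. Start with $f_{\theta_0}=0$, and let $\pi_{\theta_k}\propto\exp\{\tau_k^{-1}f_{\theta_k}\}$,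 $\sigma_k=\sigma_{\pi_{\theta_k}}$; in particular $\pi_0=\pi_{\theta_0}$ is uniform. In iteration $k=0,\dots,K-1$, given the past, draw $T$ i.i.d. samples $(s,a)\sim\sigma_k$, $a^0\sim\pi_0(\cdot\,|\,s)$, $s'\sim\mathcal P(\cdot\,|\,s,a)$, $a'\sim\pi_{\theta_k}(\cdot\,|\,s')$, and use the $(t+1)$-st sample in step $t$ of both of the following loops. - Policy evaluation (projected TD): starting from $\omega(0)=\alpha(0)$, for $t=0,\dots,T-1$, $$\omega(t+1)=\Pi_{\mathcal B^0(R_Q)}\Big(\omega(t)-\eta\big(Q_{\omega(t)}(s,a)-(1-\gamma)r(s,a)-\gamma Q_{\omega(t)}(s',a')\big)\nabla_\omega Q_{\omega(t)}(s,a)\Big),$$ where $Q_\omega=u_\omega$. The output is $Q_{\omega_k}=Q_{\overline\omega}$ with $\overline\omega=T^{-1}\sum_{t=0}^{T-1}\omega(t)$. - Policy improvement (projected SGD): starting from $\theta(0)=\alpha(0)$, for $t=0,\dots,T-1$, $$\theta(t+1)=\Pi_{\mathcal B^0(R_f)}\Big(\theta(t)-\eta\big(f_{\theta(t)}-\tau_{k+1}(\beta_k^{-1}Q_{\omega_k}+\tau_k^{-1}f_{\theta_k})\big)(s,a^0)\,\nabla_\theta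 f_{\theta(t)}(s,a^0)\Big),$$ where $f_\theta=u_\theta$. The output is $f_{\theta_{k+1}}$ with $\theta_{k+1}=T^{-1}\sum_{t=0}^{T-1}\theta(t)$. *Assumptions.* 1. $|r(s,a)|\le R_{\max}$ for all $(s,a)$, where $R_{\max}>0$. 2. $E$ is an event of the initialization on which, almost surely, $Q^\pi\in\mathcal F_{R_Q,m_Q}$ for every policy $\pi$. 3. There is $c>0$ such that $\sigma_\pi\big(|z^\top(s,a)|\le\zeta\big)\le c\,\zeta/\|z\|_2$ for every policy $\pi$, every $z\in\mathbb R^d\setminus\{0\}$ and every $\zeta>0$. *Conclusion.* For all $\gamma\in(0,1)$, $c>0$, $R_{\max}>0$ and $R_0>0$ there is a constant $C$, depending on these four numbers only, such that in every setting as above with $R_Q\ge R_0$ and $T\ge 64/(1-\gamma)^2$, and for every iteration $k<K$, $$\mathbb E\Big[\mathbf 1_E\;\mathbb E_{(s,a)\sim\sigma_k}\big[(Q_{\overline\omega}(s,a)-Q^{\pi_{\theta_k}}(s,a))^2\big]\Big]\le C\big(R_Q^2T^{-1/2}+R_Q^{5/2}m_Q^{-1/4}+R_Q^3m_Q^{-1/2}\big).$$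 The outer expectation is over the initialization and all samples. If the condition in 2 holds almost surely, one may take $E$ to be the sure event, and the left-hand side is $\mathbb E_{\mathrm{init},\sigma_k}[(Q_{\overline\omega}-Q^{\pi_{\theta_k}})^2]$. -/

import Mathlib

open MeasureTheory ProbabilityTheory
open scoped ENNReal RealInnerProductSpace

noncomputable section

namespace NeuralPPO

/-! ### Markov decision process, policies, action-value functions -/

/-- The data of a Markov decision process apart from its discount factor: a transition kernel
`P(· | s, a)`, a measurable reward and the (measurable) identification of every state-action pair
with a vector of `ℝᵈ`. -/
structure MDP (S A : Type*) [MeasurableSpace S] [MeasurableSpace A] (d : ℕ) where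
  trans : Kernel (S × A) S
  markov_trans : IsMarkovKernel trans
  reward : S × A → ℝ
  measurable_reward : Measurable reward
  feat : S × A → EuclideanSpace ℝ (Fin d)
  measurable_feat : Measurable feat

attribute [instance] MDP.markov_trans

/-- A policy `π(· | s)`: a Markov kernel from states to actions. -/
def Policy (S A : Type*) [MeasurableSpace S] [MeasurableSpace A] :=
  {π : Kernel S A // IsMarkovKernel π}

section MDP

variable {S A : Type*} [MeasurableSpace S] [MeasurableSpace A] {d : ℕ}

/-- The Markov kernel of a policy. -/
def Policy.ker (π : Policy S A) : Kernel S A := π.1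

instance (π : Policy S A) : IsMarkovKernel π.ker := π.2

/-- One step of the state-action chain: `s' ∼ P(· | s, a)` and `a' ∼ π(· | s')`. -/
def MDP.chain (M : MDP S A d) (π : Policy S A) : Kernel (S × A) (S × A) :=
  M.trans ⊗ₖ Kernel.prodMkLeft (S × A) π.ker

instance (M : MDP S A d) (π : Policy S A) : IsMarkovKernel (M.chain π) := by
  unfold MDP.chain; infer_instance

/-- The law of the whole trajectory `(s₀, a₀), (s₁, a₁), …` started at `(s₀, a₀) = x` and run
under the policy `π`. -/
def MDP.trajLaw (M : MDP S A d) (π : Policy S A) (x : S × A) : Measure (ℕ → S × A) :=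
  Kernel.traj (X := fun _ => S × A)
    (fun n => (M.chain π).comap (fun h => h ⟨n, Finset.mem_Iic.2 le_rfl⟩) (by fun_prop))
    0 (fun _ => x)

/-- The action-value function
`Q^π(s, a) = (1 - γ) E[∑ₜ γᵗ r(sₜ, aₜ) | s₀ = s, a₀ = a]`. -/
def MDP.Qfun (M : MDP S A d) (γ : ℝ) (π : Policy S A) (x : S × A) : ℝ :=
  (1 - γ) * ∫ y, ∑' t : ℕ, γ ^ t * M.reward (y t) ∂(M.trajLaw π x)

/-- The state-action distribution `σ(ds, da) = ν(ds) π(da | s)`. -/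
def stateAction (ν : Measure S) (π : Policy S A) : Measure (S × A) := ν ⊗ₘ π.ker

/-- `ν` is a stationary state distribution of the policy `π`. -/
def MDP.IsStationary (M : MDP S A d) (π : Policy S A) (ν : Measure S) : Prop :=
  IsProbabilityMeasure ν ∧ (stateAction ν π).bind M.trans = ν

end MDP

/-! ### Two-layer ReLU networks -/

/-- Input weights `α = ([α]₁, …, [α]ₘ) ∈ ℝᵐᵈ` with the Euclidean norm. -/
abbrev Weights (m d : ℕ) := PiLp 2 (fun _ : Fin m => EuclideanSpace ℝ (Fin d))

/-- An initialization: the input weights `α(0)` and the output weights `b`. -/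
abbrev Init (m d : ℕ) := Weights m d × (Fin m → ℝ)

section Network

variable {m d : ℕ}

/-- The law `N(0, I_d / d)`. -/
def gaussLaw (d : ℕ) : Measure (EuclideanSpace ℝ (Fin d)) :=
  (Measure.pi fun _ : Fin d => gaussianReal 0 (1 / (d : NNReal))).map (WithLp.toLp 2)

/-- The uniform law on `{-1, 1}`. -/
def signLaw : Measure ℝ :=
  (2 : ℝ≥0∞)⁻¹ • Measure.dirac (-1 : ℝ) + (2 : ℝ≥0∞)⁻¹ • Measure.dirac (1 : ℝ)

/-- The law of the random initialization: all `[α(0)]ᵢ ∼ N(0, I_d / d)` and all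
`bᵢ ∼ Unif {-1, 1}` are independent. -/
def initLaw (m d : ℕ) : Measure (Init m d) :=
  ((Measure.pi fun _ : Fin m => gaussLaw d).map (WithLp.toLp 2)).prod
    (Measure.pi fun _ : Fin m => signLaw)

/-- The network `u_α(x) = m^{-1/2} ∑ᵢ bᵢ max([α]ᵢᵀ x, 0)`. -/
def nn (b : Fin m → ℝ) (α : Weights m d) (x : EuclideanSpace ℝ (Fin d)) : ℝ :=
  1 / √m * ∑ i, b i * max ⟪α i, x⟫ 0

/-- The gradient of the network in `α`, whose `i`-th block is
`m^{-1/2} bᵢ 1{[α]ᵢᵀ x > 0} x`. -/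
def nnGrad (b : Fin m → ℝ) (α : Weights m d) (x : EuclideanSpace ℝ (Fin d)) : Weights m d :=
  WithLp.toLp 2 fun i => (1 / √m * b i * if 0 < ⟪α i, x⟫ then 1 else 0) • x

/-- The linearization at the initialization,
`m^{-1/2} ∑ᵢ bᵢ 1{[α(0)]ᵢᵀ x > 0} [α]ᵢᵀ x`. -/
def nnLin (v : Init m d) (α : Weights m d) (x : EuclideanSpace ℝ (Fin d)) : ℝ :=
  1 / √m * ∑ i, v.2 i * (if 0 < ⟪v.1 i, x⟫ then 1 else 0) * ⟪α i, x⟫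

/-- The function class `F_{R,m}` attached to the initialization `v = (α(0), b)`. -/
def funClass {S A : Type*} [MeasurableSpace S] [MeasurableSpace A] (M : MDP S A d)
    (R : ℝ) (v : Init m d) : Set (S × A → ℝ) :=
  {u | ∃ α : Weights m d, ‖α - v.1‖ ≤ R ∧ ∀ x, u x = nnLin v α (M.feat x)}

/-- The Euclidean projection of `α` onto the closed ball of radius `R` around `c`. -/
def projBall (c : Weights m d) (R : ℝ) (α : Weights m d) : Weights m d :=
  if ‖α - c‖ ≤ R then α else c + (R / ‖α - c‖) • (α - c)

/-- `projBall c R α` is the minimizer of the distance to `α` over the ball. -/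
theorem projBall_isMinOn (c : Weights m d) {R : ℝ} (hR : 0 ≤ R) (α : Weights m d) :
    projBall c R α ∈ Metric.closedBall c R ∧
      IsMinOn (fun β => ‖β - α‖) (Metric.closedBall c R) (projBall c R α) := by
  unfold projBall
  split_ifs with h
  · refine ⟨by simpa [dist_eq_norm] using h, fun β _ => ?_⟩
    simp
  · push Not at h
    have hpos : 0 < ‖α - c‖ := lt_of_le_of_lt hR h
    refine ⟨?_, fun β hβ => ?_⟩
    · simp only [Metric.mem_closedBall, dist_eq_norm, add_sub_cancel_left, norm_smul, norm_div,
        Real.norm_eq_abs, abs_of_nonneg hR, abs_of_pos hpos]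
      exact (div_mul_cancel₀ _ hpos.ne').le
    · have hβ' : ‖β - c‖ ≤ R := by simpa [dist_eq_norm] using hβ
      have e : c + (R / ‖α - c‖) • (α - c) - α = (R / ‖α - c‖ - 1) • (α - c) := by
        rw [sub_smul, one_smul]; abel
      have h1 : ‖c + (R / ‖α - c‖) • (α - c) - α‖ = ‖α - c‖ - R := by
        rw [e, norm_smul, Real.norm_eq_abs, abs_of_nonpos, neg_sub, sub_mul, one_mul,
          div_mul_cancel₀ _ hpos.ne']
        rw [sub_nonpos, div_le_one hpos]; exact h.le
      have h2 : ‖α - c‖ ≤ ‖β - α‖ + ‖β - c‖ := by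
        have := norm_sub_le (β - c) (β - α)
        rw [sub_sub_sub_cancel_left] at this
        linarith
      change ‖c + (R / ‖α - c‖) • (α - c) - α‖ ≤ ‖β - α‖
      linarith

end Network

/-! ### Neural PPO -/

/-- Number of PPO iterations `K`, number of TD and SGD iterations `T`, width `m = m_f = m_Q`,
penalty parameter `β`, and projection radii `R_f`, `R_Q`. -/
structure Params where
  K : ℕ
  T : ℕ
  m : ℕ
  β : ℝ
  Rf : ℝ
  RQ : ℝ

/-- The stepsize `η = T^{-1/2}`. -/
def Params.stepsize (p : Params) : ℝ := (p.T : ℝ) ^ (-(1 / 2) : ℝ)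

/-- The temperatures `τ₀ = 1` and `τ_{k+1} = β √K / (k + 1)`. -/
def Params.temp (p : Params) : ℕ → ℝ
  | 0 => 1
  | k + 1 => p.β * √p.K / (k + 1)

/-- The penalty parameter `β_k = β √K`. -/
def Params.penalty (p : Params) : ℝ := p.β * √p.K

/-- One sample point `((s, a), a⁰, (s', a'))`. -/
abbrev Sample (S A : Type*) := (S × A) × A × (S × A)

/-- The sample drawn in one PPO iteration. -/
abbrev Batch (S A : Type*) (T : ℕ) := Fin T → Sample S A

/-- The initialization together with the samples of the first `k` PPO iterations. -/
abbrev Hist (S A : Type*) (d : ℕ) (p : Params) (k : ℕ) :=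
  Init p.m d × (Fin k → Batch S A p.T)

/-- The iterates `w(0) = w₀`, `w(t + 1) = step (w(t)) (D_{t+1})` of an update rule along a finite
sample `D`. -/
def iterates {W X : Type*} {T : ℕ} (step : W → X → W) (w₀ : W) (D : Fin T → X) : ℕ → W
  | 0 => w₀
  | t + 1 =>
    if h : t < T then step (iterates step w₀ D t) (D ⟨t, h⟩) else iterates step w₀ D t

/-- The average over the path `(1 / T) ∑_{t < T} w(t)`. -/
def pathAverage {m d : ℕ} {X : Type*} {T : ℕ} (step : Weights m d → X → Weights m d)
    (w₀ : Weights m d) (D : Fin T → X) : Weights m d :=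
  (1 / (T : ℝ)) • ∑ t ∈ Finset.range T, iterates step w₀ D t

section PPO

variable {S A : Type*} [MeasurableSpace S] [MeasurableSpace A] {d : ℕ}

/-- One projected TD update. -/
def tdStep (M : MDP S A d) (γ : ℝ) (p : Params) (v : Init p.m d)
    (ω : Weights p.m d) (z : Sample S A) : Weights p.m d :=
  projBall v.1 p.RQ
    (ω - (p.stepsize * (nn v.2 ω (M.feat z.1) - (1 - γ) * M.reward z.1
      - γ * nn v.2 ω (M.feat z.2.2))) • nnGrad v.2 ω (M.feat z.1))

/-- The output `ω̄` of policy evaluation via TD. -/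
def tdOutput (M : MDP S A d) (γ : ℝ) (p : Params) (v : Init p.m d) (D : Batch S A p.T) :
    Weights p.m d :=
  pathAverage (tdStep M γ p v) v.1 D

/-- The regression target `τ_{k+1} (β_k⁻¹ Q_{ω_k} + τ_k⁻¹ f_{θ_k})` of policy improvement. -/
def target (M : MDP S A d) (p : Params) (v : Init p.m d) (k : ℕ) (f : S × A → ℝ)
    (ω : Weights p.m d) (x : S × A) : ℝ :=
  p.temp (k + 1) * (p.penalty⁻¹ * nn v.2 ω (M.feat x) + (p.temp k)⁻¹ * f x)

/-- One projected SGD update; it uses the state-action pair `(s, a⁰)`. -/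
def sgdStep (M : MDP S A d) (p : Params) (v : Init p.m d) (g : S × A → ℝ)
    (θ : Weights p.m d) (z : Sample S A) : Weights p.m d :=
  projBall v.1 p.Rf
    (θ - (p.stepsize * (nn v.2 θ (M.feat (z.1.1, z.2.1)) - g (z.1.1, z.2.1))) •
      nnGrad v.2 θ (M.feat (z.1.1, z.2.1)))

/-- The energy function `f_{θ_k}`: `f_{θ_0} = 0`, and `f_{θ_{k+1}}` is the output of policy
improvement via SGD in the `k`-th iteration, where `ω_k` is the output of policy evaluation. -/
def energy (M : MDP S A d) (γ : ℝ) (p : Params) : (k : ℕ) → Hist S A d p k → S × A → ℝ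
  | 0, _ => fun _ => 0
  | k + 1, (v, D) =>
    let f := energy M γ p k (v, Fin.init D)
    let ω := tdOutput M γ p v (D (Fin.last k))
    let θ := pathAverage (sgdStep M p v (target M p v k f ω)) v.1 (D (Fin.last k))
    fun x => nn v.2 θ (M.feat x)

theorem measurable_nn {m : ℕ} (b : Fin m → ℝ) (α : Weights m d) : Measurable (nn b α) := by
  unfold nn; fun_prop

theorem measurable_energy (M : MDP S A d) (γ : ℝ) (p : Params) (k : ℕ) (h : Hist S A d p k) :
    Measurable (energy M γ p k h) := by
  cases k with
  | zero => simp only [energy]; fun_prop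
  | succ k =>
    simp only [energy]
    exact (measurable_nn _ _).comp M.measurable_feat

variable [Fintype A]

/-- The probability `exp (f(s, a)) / ∑_{a'} exp (f(s, a'))`. -/
def softmax {S A : Type*} [Fintype A] (f : S × A → ℝ) (s : S) (a : A) : ℝ :=
  Real.exp (f (s, a)) / ∑ a', Real.exp (f (s, a'))

theorem measurable_softmax {f : S × A → ℝ} (hf : Measurable f) (a : A) :
    Measurable fun s => softmax f s a := by
  unfold softmax; fun_prop

theorem sum_softmax {S A : Type*} [Fintype A] [Nonempty A] (f : S × A → ℝ) (s : S) : ∑ a, softmax f s a = 1 := by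
  unfold softmax
  rw [← Finset.sum_div, div_self]
  exact (Finset.sum_pos (fun a _ => Real.exp_pos _) Finset.univ_nonempty).ne'

variable [MeasurableSingletonClass A] [Nonempty A]

/-- The energy-based policy `π(a | s) ∝ exp (f(s, a))`. -/
def energyPolicy (f : S × A → ℝ) (hf : Measurable f) : Policy S A :=
  ⟨{ toFun := fun s => ∑ a, ENNReal.ofReal (softmax f s a) • Measure.dirac a
     measurable' := by
      refine Measure.measurable_of_measurable_coe _ fun B hB => ?_
      simp only [Measure.coe_finsetSum, Finset.sum_apply, Measure.smul_apply, smul_eq_mul]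
      exact Finset.measurable_sum _ fun a _ =>
        (measurable_softmax hf a).ennreal_ofReal.mul_const _ },
   ⟨fun s => ⟨by
      have : ∑ a, ENNReal.ofReal (softmax f s a) = 1 := by
        rw [← ENNReal.ofReal_sum_of_nonneg, sum_softmax, ENNReal.ofReal_one]
        intro a _
        unfold softmax
        positivity
      simpa using this⟩⟩⟩

/-- The uniform policy `π₀ ∝ exp 0`. -/
def uniformPolicy : Policy S A := energyPolicy (fun _ => 0) measurable_const

/-- The policy `π_{θ_k} ∝ exp (τ_k⁻¹ f_{θ_k})`. -/
def policyAt (M : MDP S A d) (γ : ℝ) (p : Params) (k : ℕ) (h : Hist S A d p k) : Policy S A :=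
  energyPolicy (fun x => (p.temp k)⁻¹ * energy M γ p k h x)
    ((measurable_energy M γ p k h).const_mul _)

/-- The law of one sample point for the policy `π` with state distribution `ν`: `(s, a) ∼ ν π`,
`a⁰ ∼ π₀(· | s)`, `s' ∼ P(· | s, a)` and `a' ∼ π(· | s')`. -/
def sampleLaw (M : MDP S A d) (ν : Measure S) (π : Policy S A) : Measure (Sample S A) :=
  stateAction ν π ⊗ₘ
    (((uniformPolicy (S := S) (A := A)).ker.comap Prod.fst measurable_fst) ×ₖ M.chain π)

/-- The history up to the start of the `k`-th PPO iteration. -/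
def history {Ω : Type*} {p : Params} (init : Ω → Init p.m d) (D : ℕ → Ω → Batch S A p.T)
    (k : ℕ) (w : Ω) : Hist S A d p k :=
  (init w, fun j => D j w)

/-- `init` and `D 0, D 1, …` are the random initialization and the samples of a run of neural PPO
in which the stationary state distribution of `π` is `ν π`: the initialization has the prescribed
law and, given the history, the sample points of the `k`-th iteration are i.i.d. with the law
prescribed by `π_{θ_k}`. -/
structure IsRun (M : MDP S A d) (γ : ℝ) (p : Params) (ν : Policy S A → Measure S)
    {Ω : Type*} [MeasurableSpace Ω] (μ : Measure Ω)
    (init : Ω → Init p.m d) (D : ℕ → Ω → Batch S A p.T) : Prop where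
  law_init : HasLaw init (initLaw p.m d) μ
  law_sample : ∀ k < p.K, ∃ κ : Kernel (Hist S A d p k) (Batch S A p.T), IsMarkovKernel κ ∧
    (∀ᵐ h ∂(μ.map (history init D k)),
      κ h = Measure.pi fun _ : Fin p.T =>
        sampleLaw M (ν (policyAt M γ p k h)) (policyAt M γ p k h)) ∧
    HasCondDistrib (D k) (history init D k) κ μ

end PPO

end NeuralPPO

end

/-! Projected TD on the ReLU network is compared with TD on its linearization at the initialization.
The linearized problem is well posed. The network differs from it only through the neurons whose
activation has flipped, and few neurons can flip inside a ball of radius `R_Q`.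

Fix the history. Then the policy π is fixed, and on `E` the target `Q^π` is the linearization at
some β in the ball. The inner product of the initial gradient with `ω - β` is `u = nnLin ω - Q^π`.
Hence, up to flip errors, a TD step changes `‖ω - β‖²` by `-2η(u² - γ u u')` plus `η²G²` and a
multiple of the Bellman residual times `u`. The residual term has mean zero
(`integral_bellman_residual`). Young's inequality together with stationarity, `E u'² = E u²`
(`bind_chain_stateAction`), leaves the drift `-2η(1 - γ) E u²`. Telescoping
(`sum_lintegral_iterates_le`) and convexity bound the error of the averaged iterate. With `η =
T^{-1/2}` the noise contributes order `R_Q² T^{-1/2}`.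

Linearization errors are controlled by Cauchy–Schwarz over the flipped neurons. Both the network and
the gradient err by at most a multiple of `R_Q √flipFrac` (`abs_nn_sub_nnLin_le`,
`abs_inner_nnGrad_sub_le`). A neuron can flip at `x` only if its initial pre-activation is no larger
than its displacement, so assumption 3 bounds the expected flip fraction over the ball by
`flipBound`, of order `R_Q m^{-1/2}` times an average of `1/‖[α(0)]_i‖²`. This bound depends on the
initialization alone. It is uniform over weights and policies, which makes the correlation between
initialization, samples and policy harmless. Its mean is finite because `E‖w‖⁻² ≤ 3` for Gaussian
`w` with `d ≥ 3` (`lintegral_invNormSq_gaussLaw_le`). The root of the flip fraction yields the term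
with `m^{-1/4}`, and replacing the linearization by the network at the averaged iterate yields the
term with `m^{-1/2}`.

No Gaussian tail bound is needed for the TD error. The network and its linearization agree at the
initialization, and `Q^π` is bounded, so realizability itself bounds the network on the ball
(`abs_nn_le`). -/

namespace NeuralPPO

/-! ### The network, its linearization and the projection at fixed weights. -/

section Pointwise

variable {m d : ℕ}

open scoped Classical in
/-- The fraction of neurons which are active at exactly one of `ω` and the initialization. -/
noncomputable def flipFrac (v : Init m d) (ω : Weights m d) (x : EuclideanSpace ℝ (Fin d)) : ℝ :=
  1 / m * ∑ i, if (0 < ⟪ω i, x⟫ ↔ 0 < ⟪v.1 i, x⟫) then 0 else 1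

theorem flipFrac_nonneg (v : Init m d) (ω : Weights m d) (x : EuclideanSpace ℝ (Fin d)) :
    0 ≤ flipFrac v ω x := by
  unfold flipFrac
  refine mul_nonneg (by positivity) (Finset.sum_nonneg fun i _ => ?_)
  split_ifs <;> norm_num

/-- Cauchy–Schwarz with weights in `[0, 1]`, where `J² ≤ J`. Taking `J = 1` gives the Lipschitz
bounds, and taking `J` to be the flip indicator gives the linearization bounds with `√flipFrac`. -/
theorem abs_scaled_sum_le {c J : Fin m → ℝ} {β : Weights m d}
    (hJ0 : ∀ i, 0 ≤ J i) (hJ1 : ∀ i, J i ≤ 1) (hc : ∀ i, |c i| ≤ J i * ‖β i‖) :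
    |1 / √m * ∑ i, c i| ≤ ‖β‖ * √(1 / m * ∑ i, J i) := by
  refine abs_le_of_sq_le_sq ?_ (by positivity)
  have hS : |∑ i, c i| ≤ ∑ i, J i * ‖β i‖ :=
    (Finset.abs_sum_le_sum_abs _ _).trans (Finset.sum_le_sum fun i _ => hc i)
  have hJs : 0 ≤ ∑ i, J i := Finset.sum_nonneg fun i _ => hJ0 i
  have h2 : (∑ i, c i) ^ 2 ≤ (∑ i, J i) * ‖β‖ ^ 2 := by
    calc (∑ i, c i) ^ 2 = |∑ i, c i| ^ 2 := (sq_abs _).symm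
      _ ≤ (∑ i, J i * ‖β i‖) ^ 2 := by gcongr
      _ ≤ (∑ i, J i ^ 2) * ∑ i, ‖β i‖ ^ 2 := Finset.sum_mul_sq_le_sq_mul_sq _ _ _
      _ ≤ (∑ i, J i) * ∑ i, ‖β i‖ ^ 2 := by
        gcongr with i
        nlinarith [hJ0 i, hJ1 i]
      _ = _ := by rw [PiLp.norm_sq_eq_of_L2]
  rw [mul_pow, mul_pow, Real.sq_sqrt (by positivity), div_pow, one_pow,
    Real.sq_sqrt (Nat.cast_nonneg m)]
  calc 1 / (m : ℝ) * (∑ i, c i) ^ 2 ≤ 1 / (m : ℝ) * ((∑ i, J i) * ‖β‖ ^ 2) := by gcongr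
    _ = _ := by ring

theorem inner_nnGrad (b : Fin m → ℝ) (ω β : Weights m d) (x : EuclideanSpace ℝ (Fin d)) :
    ⟪nnGrad b ω x, β⟫ = 1 / √m * ∑ i, b i * (if 0 < ⟪ω i, x⟫ then 1 else 0) * ⟪β i, x⟫ := by
  rw [PiLp.inner_apply, Finset.mul_sum]
  refine Finset.sum_congr rfl fun i _ => ?_
  simp only [nnGrad, real_inner_smul_left]
  rw [real_inner_comm x (β i)]
  ring

theorem nn_eq_inner (b : Fin m → ℝ) (ω : Weights m d) (x : EuclideanSpace ℝ (Fin d)) :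
    nn b ω x = ⟪nnGrad b ω x, ω⟫ := by
  rw [inner_nnGrad, nn]
  congr 1
  refine Finset.sum_congr rfl fun i _ => ?_
  split_ifs with h
  · rw [max_eq_left h.le, mul_one]
  · rw [max_eq_right (not_lt.1 h)]; ring

theorem nnLin_eq_inner (v : Init m d) (ω : Weights m d) (x : EuclideanSpace ℝ (Fin d)) :
    nnLin v ω x = ⟪nnGrad v.2 v.1 x, ω⟫ := by
  rw [inner_nnGrad, nnLin]

theorem abs_inner_le_norm {x : EuclideanSpace ℝ (Fin d)} (hx : ‖x‖ ≤ 1)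
    (y : EuclideanSpace ℝ (Fin d)) : |⟪y, x⟫| ≤ ‖y‖ :=
  (abs_real_inner_le_norm y x).trans (by nlinarith [norm_nonneg y])

theorem sqrt_mean_one_le (m : ℕ) : √(1 / (m : ℝ) * ∑ _i : Fin m, (1 : ℝ)) ≤ 1 := by
  rw [Real.sqrt_le_left zero_le_one, one_pow]
  simp only [Finset.sum_const, Finset.card_univ, Fintype.card_fin, nsmul_eq_mul, mul_one]
  rw [one_div, inv_mul_eq_div]
  exact div_self_le_one _

theorem abs_inner_nnGrad_le {b : Fin m → ℝ} (hb : ∀ i, |b i| = 1) (ω β : Weights m d)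
    {x : EuclideanSpace ℝ (Fin d)} (hx : ‖x‖ ≤ 1) : |⟪nnGrad b ω x, β⟫| ≤ ‖β‖ := by
  rw [inner_nnGrad]
  refine (abs_scaled_sum_le (J := fun _ => 1) (β := β) (by simp) (by simp) fun i => ?_).trans ?_
  · rw [abs_mul, abs_mul, hb]
    have := abs_inner_le_norm hx (β i)
    split_ifs
    · simpa using this
    · simp
  · have := sqrt_mean_one_le m
    nlinarith [norm_nonneg β]

theorem norm_nnGrad_le {b : Fin m → ℝ} (hb : ∀ i, |b i| = 1) (ω : Weights m d)
    {x : EuclideanSpace ℝ (Fin d)} (hx : ‖x‖ ≤ 1) : ‖nnGrad b ω x‖ ≤ 1 := by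
  have h := abs_inner_nnGrad_le hb ω (nnGrad b ω x) hx
  -- Testing against the gradient itself gives `‖g‖² ≤ ‖g‖`.
  rw [real_inner_self_eq_norm_sq, abs_of_nonneg (by positivity)] at h
  by_contra! h'
  nlinarith

theorem abs_inner_nnGrad_sub_le {v : Init m d} (hb : ∀ i, |v.2 i| = 1) (ω β : Weights m d)
    {x : EuclideanSpace ℝ (Fin d)} (hx : ‖x‖ ≤ 1) :
    |⟪nnGrad v.2 ω x, β⟫ - ⟪nnGrad v.2 v.1 x, β⟫| ≤ ‖β‖ * √(flipFrac v ω x) := by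
  classical
  rw [inner_nnGrad, inner_nnGrad, ← mul_sub, ← Finset.sum_sub_distrib]
  unfold flipFrac
  refine abs_scaled_sum_le (β := β) (fun i => ?_) (fun i => ?_) fun i => ?_
  · split_ifs <;> norm_num
  · split_ifs <;> norm_num
  · rw [← sub_mul, ← mul_sub, abs_mul, abs_mul, hb, one_mul]
    have := abs_inner_le_norm hx (β i)
    by_cases h1 : 0 < ⟪ω i, x⟫ <;> by_cases h2 : 0 < ⟪v.1 i, x⟫ <;> simp [h1, h2, this]

/-- Only flipped neurons contribute. There the two pre-activations lie on opposite sides of zero, so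
that of `ω` is at most their difference. This is why the bound involves `‖ω - v.1‖` and not `‖ω‖`.
-/
theorem abs_nn_sub_nnLin_le {v : Init m d} (hb : ∀ i, |v.2 i| = 1) (ω : Weights m d)
    {x : EuclideanSpace ℝ (Fin d)} (hx : ‖x‖ ≤ 1) :
    |nn v.2 ω x - nnLin v ω x| ≤ ‖ω - v.1‖ * √(flipFrac v ω x) := by
  classical
  rw [nn_eq_inner, nnLin_eq_inner, inner_nnGrad, inner_nnGrad, ← mul_sub,
    ← Finset.sum_sub_distrib]
  unfold flipFrac
  refine abs_scaled_sum_le (β := ω - v.1) (fun i => ?_) (fun i => ?_) fun i => ?_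
  · split_ifs <;> norm_num
  · split_ifs <;> norm_num
  · rw [← sub_mul, ← mul_sub, abs_mul, abs_mul, hb, one_mul]
    have h := abs_inner_le_norm hx ((ω - v.1) i)
    rw [PiLp.sub_apply, inner_sub_left] at h
    have h' := abs_le.1 h
    by_cases h1 : 0 < ⟪ω i, x⟫ <;> by_cases h2 : 0 < ⟪v.1 i, x⟫ <;>
      simp only [h1, h2, if_true, if_false, sub_self, sub_zero, zero_sub, abs_zero, abs_neg,
        abs_one, zero_mul, one_mul, iff_true, iff_false, not_true,
        PiLp.sub_apply, le_refl] <;> rw [abs_le] <;> constructor <;> linarith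

theorem abs_nn_sub_nn_le {b : Fin m → ℝ} (hb : ∀ i, |b i| = 1) (ω β : Weights m d)
    {x : EuclideanSpace ℝ (Fin d)} (hx : ‖x‖ ≤ 1) : |nn b ω x - nn b β x| ≤ ‖ω - β‖ := by
  unfold nn
  rw [← mul_sub, ← Finset.sum_sub_distrib]
  refine (abs_scaled_sum_le (J := fun _ => 1) (β := ω - β) (by simp) (by simp) fun i => ?_).trans ?_
  · rw [← mul_sub, abs_mul, hb, one_mul]
    refine (abs_max_sub_max_le_abs _ _ _).trans ?_
    rw [← inner_sub_left, one_mul]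
    exact abs_inner_le_norm hx _
  · have := sqrt_mean_one_le m
    nlinarith [norm_nonneg (ω - β)]

theorem nn_init_eq_nnLin (v : Init m d) (x : EuclideanSpace ℝ (Fin d)) :
    nn v.2 v.1 x = nnLin v v.1 x := by
  rw [nn_eq_inner, nnLin_eq_inner]

theorem nnLin_sub (v : Init m d) (ω β : Weights m d) (x : EuclideanSpace ℝ (Fin d)) :
    nnLin v ω x - nnLin v β x = ⟪nnGrad v.2 v.1 x, ω - β⟫ := by
  rw [nnLin_eq_inner, nnLin_eq_inner, inner_sub_right]

/-- One `R` moves the linearization from `β` to the centre, where it coincides with the network; the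
other moves the network from the centre to `ω`. Applied with `nnLin v β = Q^π`, this gives a
deterministic bound on the whole ball. -/
theorem abs_nn_le {v : Init m d} (hb : ∀ i, |v.2 i| = 1) {ω β : Weights m d} {R B : ℝ}
    (hω : ‖ω - v.1‖ ≤ R) (hβ : ‖β - v.1‖ ≤ R)
    {x : EuclideanSpace ℝ (Fin d)} (hx : ‖x‖ ≤ 1) (hB : |nnLin v β x| ≤ B) :
    |nn v.2 ω x| ≤ B + 2 * R := by
  have h1 := abs_nn_sub_nn_le hb ω v.1 hx
  have h2 := abs_inner_nnGrad_le hb v.1 (β - v.1) hx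
  rw [← nnLin_sub, ← nn_init_eq_nnLin] at h2
  rw [abs_le] at *
  constructor <;> linarith

/-- With `r = α - c`, `q = β - c` and scaling factor `t`, the squared distances differ by `(1 -
t)((1 - t)‖r‖² + 2(t‖r‖² - ⟪r, q⟫))`, which is nonnegative since `⟪r, q⟫ ≤ ‖r‖R = t‖r‖²`. -/
theorem norm_projBall_sub_le {c β : Weights m d} {R : ℝ} (hβ : ‖β - c‖ ≤ R) (α : Weights m d) :
    ‖projBall c R α - β‖ ≤ ‖α - β‖ := by
  have hR : 0 ≤ R := (norm_nonneg _).trans hβ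
  unfold projBall
  split_ifs with h
  · exact le_rfl
  push Not at h
  have hpos : 0 < ‖α - c‖ := lt_of_le_of_lt hR h
  set t := R / ‖α - c‖ with ht
  have ht0 : 0 ≤ t := by positivity
  have ht1 : t ≤ 1 := (div_le_one hpos).2 h.le
  have htR : t * ‖α - c‖ = R := div_mul_cancel₀ _ hpos.ne'
  have e1 : c + t • (α - c) - β = t • (α - c) - (β - c) := by abel
  have e2 : α - β = (α - c) - (β - c) := by abel
  rw [e1, e2]
  refine abs_le_of_sq_le_sq' ?_ (norm_nonneg _) |>.2
  generalize β - c = q at hβ ⊢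
  generalize α - c = r at ht hpos h htR ⊢
  rw [norm_sub_sq_real, norm_sub_sq_real, norm_smul, real_inner_smul_left, Real.norm_eq_abs,
    abs_of_nonneg ht0]
  have hi : ⟪r, q⟫ ≤ ‖r‖ * R := (real_inner_le_norm _ _).trans (by gcongr)
  rw [← htR] at hi
  nlinarith [mul_nonneg (sub_nonneg.2 ht1) (sub_nonneg.2 hi), sq_nonneg ((1 - t) * ‖r‖)]

theorem norm_projBall_sub_center_le {c : Weights m d} {R : ℝ} (hR : 0 ≤ R) (α : Weights m d) :
    ‖projBall c R α - c‖ ≤ R := by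
  simpa [dist_eq_norm] using (projBall_isMinOn c hR α).1

end Pointwise

/-! ### Inverse moments of the Gaussian initialization. -/

section Initialization

open Filter Topology

theorem lintegral_exp_neg_mul_sq_gaussianReal {v : NNReal} (hv : v ≠ 0) {s : ℝ} (hs : 0 ≤ s) :
    ∫⁻ y, ENNReal.ofReal (Real.exp (-s * y ^ 2)) ∂(gaussianReal 0 v)
      = ENNReal.ofReal ((1 + 2 * s * v) ^ (-(1 / 2) : ℝ)) := by
  have hv' : (0 : ℝ) < v := by positivity
  rw [gaussianReal_of_var_ne_zero _ hv, lintegral_withDensity_eq_lintegral_mul _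
    (measurable_gaussianPDF _ _) (by fun_prop)]
  have hb : 0 < 1 / (2 * (v : ℝ)) + s := by positivity
  have e : ∀ y : ℝ, (gaussianPDF 0 v * fun y => ENNReal.ofReal (Real.exp (-s * y ^ 2))) y
      = ENNReal.ofReal ((√(2 * Real.pi * v))⁻¹ * Real.exp (-(1 / (2 * (v : ℝ)) + s) * y ^ 2)) := by
    intro y
    rw [Pi.mul_apply, gaussianPDF, ← ENNReal.ofReal_mul (gaussianPDFReal_nonneg _ _ _),
      gaussianPDFReal, mul_assoc, ← Real.exp_add]
    congr 3
    field_simp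
    ring
  simp_rw [e]
  rw [← ofReal_integral_eq_lintegral_ofReal ((integrable_exp_neg_mul_sq hb).const_mul _)
    (Eventually.of_forall fun y => by positivity), integral_const_mul, integral_gaussian]
  congr 1
  rw [Real.rpow_neg (by positivity), ← Real.sqrt_eq_rpow, ← Real.sqrt_inv, ← Real.sqrt_inv,
    ← Real.sqrt_mul (by positivity)]
  congr 1
  have := Real.pi_pos
  field_simp

instance (d : ℕ) : IsProbabilityMeasure (gaussLaw d) :=
  Measure.isProbabilityMeasure_map (by fun_prop)

instance : IsProbabilityMeasure signLaw := ⟨by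
  simp [signLaw, ENNReal.inv_two_add_inv_two]⟩

instance (m d : ℕ) : IsProbabilityMeasure (initLaw m d) := by
  unfold initLaw
  have : IsProbabilityMeasure ((Measure.pi fun _ : Fin m => gaussLaw d).map (WithLp.toLp 2)) :=
    Measure.isProbabilityMeasure_map (by fun_prop)
  infer_instance

theorem lintegral_exp_neg_mul_norm_sq_gaussLaw {d : ℕ} (hd : 0 < d) {s : ℝ} (hs : 0 ≤ s) :
    ∫⁻ w, ENNReal.ofReal (Real.exp (-s * ‖w‖ ^ 2)) ∂(gaussLaw d)
      = ENNReal.ofReal ((1 + 2 * s / d) ^ (-(d / 2) : ℝ)) := by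
  rw [gaussLaw, lintegral_map (by fun_prop) (by fun_prop)]
  have e : ∀ y : Fin d → ℝ, ENNReal.ofReal (Real.exp (-s * ‖(WithLp.toLp 2 y)‖ ^ 2))
      = ∏ i, ENNReal.ofReal (Real.exp (-s * y i ^ 2)) := by
    intro y
    rw [EuclideanSpace.norm_sq_eq, Finset.mul_sum, Real.exp_sum,
      ENNReal.ofReal_prod_of_nonneg fun i _ => (Real.exp_pos _).le]
    simp
  simp_rw [e]
  have hv : (1 / (d : NNReal)) ≠ 0 := by positivity
  have hind := iIndepFun_pi (μ := fun _ : Fin d => gaussianReal 0 (1 / (d : NNReal)))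
    (X := fun _ y => ENNReal.ofReal (Real.exp (-s * y ^ 2))) fun i => by fun_prop
  rw [lintegral_prod_eq_prod_lintegral_of_indepFun _ _ hind fun i => by fun_prop]
  have e2 : ∀ i : Fin d, ∫⁻ y : Fin d → ℝ, ENNReal.ofReal (Real.exp (-s * y i ^ 2))
      ∂(Measure.pi fun _ : Fin d => gaussianReal 0 (1 / (d : NNReal)))
      = ENNReal.ofReal ((1 + 2 * s / d) ^ (-(1 / 2) : ℝ)) := by
    intro i
    rw [(measurePreserving_eval (fun _ : Fin d => gaussianReal 0 (1 / (d : NNReal)))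
      i).lintegral_comp (f := fun y => ENNReal.ofReal (Real.exp (-s * y ^ 2))) (by fun_prop),
      lintegral_exp_neg_mul_sq_gaussianReal hv hs]
    congr 3
    push_cast
    ring
  have hpos : 0 ≤ 1 + 2 * s / d := by positivity
  simp_rw [e2]
  rw [Finset.prod_const, Finset.card_univ, Fintype.card_fin,
    ← ENNReal.ofReal_pow (Real.rpow_nonneg hpos _), ← Real.rpow_natCast, ← Real.rpow_mul hpos]
  congr 2
  ring

/-- Bernoulli's inequality with exponent `d / 3 ≥ 1` reduces every dimension to `d = 3`, the least
one for which the Laplace transform is integrable at infinity. -/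
theorem one_add_rpow_neg_half_le {d : ℕ} (hd : 3 ≤ d) {s : ℝ} (hs : 0 ≤ s) :
    (1 + 2 * s / d) ^ (-(d / 2) : ℝ) ≤ (1 + 2 * s / 3) ^ (-(3 / 2) : ℝ) := by
  have hd' : (3 : ℝ) ≤ d := by exact_mod_cast hd
  have hx : 0 ≤ 2 * s / d := by positivity
  have h1 : 1 + 2 * s / 3 ≤ (1 + 2 * s / d) ^ ((d : ℝ) / 3) := by
    have := one_add_mul_self_le_rpow_one_add (s := 2 * s / d) (by linarith) (p := d / 3)
      (by linarith)
    refine le_trans (le_of_eq ?_) this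
    field_simp
  have h2 : (1 + 2 * s / d) ^ (-(d / 2) : ℝ)
      = ((1 + 2 * s / d) ^ ((d : ℝ) / 3)) ^ (-(3 / 2) : ℝ) := by
    rw [← Real.rpow_mul (by linarith)]
    congr 1
    ring
  rw [h2]
  exact Real.rpow_le_rpow_of_nonpos (by positivity) h1 (by norm_num)

theorem lintegral_one_add_rpow :
    ∫⁻ s in Set.Ioi (0 : ℝ), ENNReal.ofReal ((1 + 2 * s / 3) ^ (-(3 / 2) : ℝ)) = 3 := by
  have hder : ∀ s ∈ Set.Ici (0 : ℝ), HasDerivAt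
      (fun s : ℝ => -3 * (1 + 2 * s / 3) ^ (-(1 / 2) : ℝ))
      ((1 + 2 * s / 3) ^ (-(3 / 2) : ℝ)) s := by
    intro s hs
    have hs' : (0 : ℝ) ≤ s := hs
    have h1 : HasDerivAt (fun s : ℝ => 1 + 2 * s / 3) (2 / 3) s := by
      simpa using (((hasDerivAt_id s).const_mul 2).div_const 3).const_add 1
    have h2 := (h1.rpow_const (p := (-(1 / 2) : ℝ)) (Or.inl (by positivity))).const_mul (-3)
    refine h2.congr_deriv ?_
    rw [show (-(1 / 2) - 1 : ℝ) = -(3 / 2) by norm_num]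
    ring
  have hlim : Tendsto (fun s : ℝ => -3 * (1 + 2 * s / 3) ^ (-(1 / 2) : ℝ)) atTop (𝓝 0) := by
    have h1 : Tendsto (fun s : ℝ => 1 + 2 * s / 3) atTop atTop :=
      tendsto_atTop_add_const_left _ _
        ((tendsto_id.const_mul_atTop two_pos).atTop_div_const three_pos)
    simpa using ((tendsto_rpow_neg_atTop (by norm_num : (0 : ℝ) < 1 / 2)).comp h1).const_mul (-3)
  have hpos : ∀ s ∈ Set.Ioi (0 : ℝ), 0 ≤ (1 + 2 * s / 3) ^ (-(3 / 2) : ℝ) := by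
    intro s hs
    have hs' : (0 : ℝ) < s := hs
    positivity
  rw [← ofReal_integral_eq_lintegral_ofReal (integrableOn_Ioi_deriv_of_nonneg' hder hpos hlim)
    ((ae_restrict_iff' measurableSet_Ioi).2 (Eventually.of_forall hpos)),
    integral_Ioi_of_hasDerivAt_of_nonneg' hder hpos hlim]
  norm_num

/-- `1 / ‖w‖²`, infinite at `w = 0`. -/
noncomputable def invNormSq {d : ℕ} (w : EuclideanSpace ℝ (Fin d)) : ℝ≥0∞ :=
  (ENNReal.ofReal (‖w‖ ^ 2))⁻¹

theorem measurable_invNormSq {d : ℕ} : Measurable (invNormSq (d := d)) := by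
  unfold invNormSq
  fun_prop

/-- The formula `1/r = ∫ e^{-sr} ds`, with both sides infinite at `r = 0`. It turns the inverse
moment of `‖w‖²` into an integral of its Laplace transform, which factorizes over coordinates. -/
theorem inv_ofReal_le_lintegral_exp {r : ℝ} (hr : 0 ≤ r) :
    (ENNReal.ofReal r)⁻¹ ≤ ∫⁻ s in Set.Ioi (0 : ℝ), ENNReal.ofReal (Real.exp (-s * r)) := by
  rcases hr.eq_or_lt with rfl | hr
  · simp
  · have e : ∀ s : ℝ, -s * r = -r * s := fun s => by ring
    simp_rw [e]
    rw [← ofReal_integral_eq_lintegral_ofReal (integrableOn_exp_mul_Ioi (by linarith) 0)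
      (Eventually.of_forall fun s => (Real.exp_pos _).le), integral_exp_mul_Ioi (by linarith),
      ← ENNReal.ofReal_inv_of_pos hr]
    simp

/-- `E ‖w‖⁻² ≤ 3` for `w ∼ N(0, I_d / d)`, `d ≥ 3`. -/
theorem lintegral_invNormSq_gaussLaw_le {d : ℕ} (hd : 3 ≤ d) :
    ∫⁻ w, invNormSq w ∂(gaussLaw d) ≤ 3 := by
  calc ∫⁻ w, invNormSq w ∂(gaussLaw d)
      ≤ ∫⁻ w, (∫⁻ s in Set.Ioi (0 : ℝ), ENNReal.ofReal (Real.exp (-s * ‖w‖ ^ 2))) ∂(gaussLaw d) :=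
        lintegral_mono fun w => inv_ofReal_le_lintegral_exp (by positivity)
    _ = ∫⁻ s in Set.Ioi (0 : ℝ), ∫⁻ w, ENNReal.ofReal (Real.exp (-s * ‖w‖ ^ 2)) ∂(gaussLaw d) :=
        lintegral_lintegral_swap (by fun_prop)
    _ ≤ ∫⁻ s in Set.Ioi (0 : ℝ), ENNReal.ofReal ((1 + 2 * s / 3) ^ (-(3 / 2) : ℝ)) := by
        refine setLIntegral_mono' measurableSet_Ioi fun s hs => ?_
        rw [lintegral_exp_neg_mul_norm_sq_gaussLaw (by omega) (le_of_lt hs)]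
        exact ENNReal.ofReal_le_ofReal (one_add_rpow_neg_half_le hd (le_of_lt hs))
    _ = 3 := lintegral_one_add_rpow

variable {m d : ℕ}

theorem measurePreserving_init_fst (i : Fin m) :
    MeasurePreserving (fun v : Init m d => v.1 i) (initLaw m d) (gaussLaw d) := by
  have h0 : MeasurePreserving (WithLp.toLp 2 : (Fin m → EuclideanSpace ℝ (Fin d)) → Weights m d)
      (Measure.pi fun _ : Fin m => gaussLaw d)
      ((Measure.pi fun _ : Fin m => gaussLaw d).map (WithLp.toLp 2)) :=
    ⟨by fun_prop, rfl⟩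
  have : IsProbabilityMeasure ((Measure.pi fun _ : Fin m => gaussLaw d).map (WithLp.toLp 2)) :=
    Measure.isProbabilityMeasure_map (by fun_prop)
  have h1 : MeasurePreserving (fun w : Weights m d => w i)
      ((Measure.pi fun _ : Fin m => gaussLaw d).map (WithLp.toLp 2)) (gaussLaw d) := by
    refine ⟨by fun_prop, ?_⟩
    rw [Measure.map_map (by fun_prop) (by fun_prop)]
    exact (measurePreserving_eval (fun _ : Fin m => gaussLaw d) i).map_eq
  exact h1.comp measurePreserving_fst

theorem lintegral_sum_invNormSq_initLaw_le (hd : 3 ≤ d) :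
    ∫⁻ v, ∑ i, invNormSq (v.1 i) ∂(initLaw m d) ≤ m * 3 := by
  rw [lintegral_finsetSum (f := fun (i : Fin m) (v : Init m d) => invNormSq (v.1 i)) _ fun i _ =>
    measurable_invNormSq.comp (measurePreserving_init_fst i).measurable]
  calc ∑ i : Fin m, ∫⁻ v, invNormSq (v.1 i) ∂(initLaw m d) ≤ ∑ i : Fin m, 3 := by
        refine Finset.sum_le_sum fun i _ => ?_
        rw [(measurePreserving_init_fst i).lintegral_comp measurable_invNormSq]
        exact lintegral_invNormSq_gaussLaw_le hd
    _ = m * 3 := by simp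

theorem ae_abs_sign_eq_one : ∀ᵐ v ∂(initLaw m d), ∀ i, |v.2 i| = 1 := by
  rw [ae_all_iff]
  intro i
  have h0 : ∀ᵐ y ∂signLaw, |y| = 1 := by
    unfold signLaw
    rw [ae_add_measure_iff]
    constructor <;> refine Measure.ae_smul_measure ?_ _ <;>
      exact (ae_dirac_iff (measurableSet_eq_fun (by fun_prop) (by fun_prop))).2 (by simp)
  have : IsProbabilityMeasure ((Measure.pi fun _ : Fin m => gaussLaw d).map (WithLp.toLp 2)) :=
    Measure.isProbabilityMeasure_map (by fun_prop)
  have h1 : MeasurePreserving (fun v : Init m d => v.2 i) (initLaw m d) signLaw :=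
    (measurePreserving_eval (fun _ : Fin m => signLaw) i).comp measurePreserving_snd
  exact h1.quasiMeasurePreserving.ae h0

end Initialization

/-! ### The action-value function, the Bellman equation and stationarity. -/

section ValueFunction

variable {S A : Type*} [MeasurableSpace S] [MeasurableSpace A] {d : ℕ}

/-- The expectation of `f` after one step of the chain. -/
noncomputable def stepMean (M : MDP S A d) (π : Policy S A) (f : S × A → ℝ) (x : S × A) : ℝ :=
  ∫ y, f y ∂(M.chain π x)

theorem integrable_of_abs_le {X : Type*} [MeasurableSpace X] {μ : Measure X} [IsFiniteMeasure μ]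
    {f : X → ℝ} (hf : Measurable f) {B : ℝ} (hB : ∀ x, |f x| ≤ B) : Integrable f μ :=
  Integrable.of_bound hf.aestronglyMeasurable B (Filter.Eventually.of_forall hB)

theorem abs_integral_le_of_abs_le {X : Type*} [MeasurableSpace X] {μ : Measure X}
    [IsProbabilityMeasure μ] {f : X → ℝ} {B : ℝ} (hB : ∀ x, |f x| ≤ B) : |∫ x, f x ∂μ| ≤ B := by
  have h : ∀ᵐ x ∂μ, ‖f x‖ ≤ B := Filter.Eventually.of_forall hB
  simpa using norm_integral_le_of_norm_le_const h

variable (M : MDP S A d) (π : Policy S A)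

theorem measurable_stepMean {f : S × A → ℝ} (hf : Measurable f) : Measurable (stepMean M π f) :=
  (hf.stronglyMeasurable.integral_kernel (κ := M.chain π)).measurable

theorem measurable_stepMean_iterate (t : ℕ) : Measurable ((stepMean M π)^[t] M.reward) := by
  induction t with
  | zero => exact M.measurable_reward
  | succ t ih => rw [Function.iterate_succ']; exact measurable_stepMean M π ih

variable {M} {π}

theorem abs_stepMean_le {f : S × A → ℝ} {B : ℝ} (hB : ∀ x, |f x| ≤ B) (x : S × A) :
    |stepMean M π f x| ≤ B := abs_integral_le_of_abs_le hB

theorem abs_stepMean_iterate_le {B : ℝ} (hB : ∀ x, |M.reward x| ≤ B) (t : ℕ) :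
    ∀ x, |(stepMean M π)^[t] M.reward x| ≤ B := by
  induction t with
  | zero => exact hB
  | succ t ih => rw [Function.iterate_succ']; exact abs_stepMean_le ih

instance (x : S × A) : IsProbabilityMeasure (M.trajLaw π x) := by
  unfold MDP.trajLaw; infer_instance

theorem map_trajLaw_zero (x : S × A) :
    (M.trajLaw π x).map (fun y => y 0) = Measure.dirac x := by
  have e : (fun y : ℕ → S × A => y 0) =
      (fun h : (i : Finset.Iic 0) → S × A => h ⟨0, Finset.mem_Iic.2 le_rfl⟩) ∘
        Preorder.frestrictLe (π := fun _ => S × A) 0 := rfl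
  rw [e, ← Measure.map_map (by fun_prop) (by fun_prop), MDP.trajLaw,
    Kernel.traj_map_frestrictLe_apply, Kernel.partialTraj_self, Kernel.id_apply,
    Measure.map_dirac' (by fun_prop)]

/-- The Ionescu-Tulcea law of the prefix up to `t + 1` extends that of the prefix up to `t` by a
kernel which reads only the last coordinate. -/
theorem map_trajLaw_succ (x : S × A) (t : ℕ) :
    (M.trajLaw π x).map (fun y => y (t + 1)) =
      ((M.trajLaw π x).map (fun y => y t)).bind (M.chain π) := by
  have e : ∀ n, (fun y : ℕ → S × A => y n) =
      (fun h : (i : Finset.Iic n) → S × A => h ⟨n, Finset.mem_Iic.2 le_rfl⟩) ∘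
        Preorder.frestrictLe (π := fun _ => S × A) n := fun n => rfl
  have me : ∀ n : ℕ, Measurable
      fun h : (i : Finset.Iic n) → S × A => h ⟨n, Finset.mem_Iic.2 le_rfl⟩ :=
    fun n => measurable_pi_apply (⟨n, Finset.mem_Iic.2 le_rfl⟩ : Finset.Iic n)
  have mf : ∀ n, Measurable (Preorder.frestrictLe (π := fun _ : ℕ => S × A) n) :=
    fun n => by fun_prop
  rw [e t, e (t + 1), ← Measure.map_map (me _) (mf _), ← Measure.map_map (me _) (mf _),
    MDP.trajLaw,
    Kernel.traj_map_frestrictLe_apply, Kernel.traj_map_frestrictLe_apply,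
    Kernel.partialTraj_succ_eq_comp (Nat.zero_le t), Kernel.comp_apply,
    Measure.map_comp _ _ (me _), Kernel.map_partialTraj_succ_self]
  ext B hB
  rw [Measure.bind_apply hB (Kernel.aemeasurable _), Measure.bind_apply hB (Kernel.aemeasurable _),
    lintegral_map (Kernel.measurable_coe _ hB) (me _)]
  rfl

/-- The function `f` stays general inside the induction, since the step from `t` to `t + 1` replaces
it by its one-step mean. -/
theorem integral_trajLaw (x : S × A) (t : ℕ) : ∀ {f : S × A → ℝ} (_ : Measurable f) {B : ℝ}
    (_ : ∀ x, |f x| ≤ B), ∫ y, f (y t) ∂(M.trajLaw π x) = (stepMean M π)^[t] f x := by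
  induction t with
  | zero =>
    intro f hf B hB
    have h := integral_map (μ := M.trajLaw π x) (φ := fun y => y 0)
      (measurable_pi_apply _).aemeasurable
      hf.aestronglyMeasurable
    rw [← h, map_trajLaw_zero, integral_dirac' _ _ hf.stronglyMeasurable]
    rfl
  | succ t ih =>
    intro f hf B hB
    rw [Function.iterate_succ, Function.comp_apply,
      ← ih (measurable_stepMean M π hf) (abs_stepMean_le hB)]
    have h := integral_map (μ := M.trajLaw π x) (φ := fun y => y (t + 1))
      (measurable_pi_apply _).aemeasurable
      hf.aestronglyMeasurable
    have h' := integral_map (μ := M.trajLaw π x) (φ := fun y => y t)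
      (measurable_pi_apply _).aemeasurable
      (measurable_stepMean M π hf).aestronglyMeasurable
    have : IsProbabilityMeasure ((M.trajLaw π x).map (fun y => y t)) :=
      Measure.isProbabilityMeasure_map (measurable_pi_apply _).aemeasurable
    rw [← h, ← h', map_trajLaw_succ, Measure.comp_eq_comp_const_apply,
      Kernel.integral_comp (integrable_of_abs_le hf hB), Kernel.const_apply]
    rfl

section Discount

variable {γ Rmax : ℝ}

theorem abs_discounted_le (hγ0 : 0 < γ) {r : ℝ} (hr : |r| ≤ Rmax) (t : ℕ) :
    |γ ^ t * r| ≤ Rmax * γ ^ t := by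
  rw [abs_mul, abs_of_nonneg (by positivity), mul_comm]
  gcongr

theorem summable_discounted (hγ0 : 0 < γ) (hγ1 : γ < 1) {r : ℕ → ℝ} (hr : ∀ t, |r t| ≤ Rmax) :
    Summable fun t => γ ^ t * r t :=
  Summable.of_norm_bounded ((summable_geometric_of_lt_one hγ0.le hγ1).mul_left Rmax)
    fun t => abs_discounted_le hγ0 (hr t) t

theorem abs_tsum_discounted_le (hγ0 : 0 < γ) (hγ1 : γ < 1) {r : ℕ → ℝ} (hr : ∀ t, |r t| ≤ Rmax) :
    |∑' t, γ ^ t * r t| ≤ Rmax * (1 - γ)⁻¹ := by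
  rw [← Real.norm_eq_abs]
  exact tsum_of_norm_bounded ((hasSum_geometric_of_lt_one hγ0.le hγ1).mul_left Rmax)
    fun t => abs_discounted_le hγ0 (hr t) t

theorem integral_tsum_discounted (hγ0 : 0 < γ) (hγ1 : γ < 1) {X : Type*} [MeasurableSpace X]
    {μ : Measure X} [IsProbabilityMeasure μ] {r : ℕ → X → ℝ} (hm : ∀ t, Measurable (r t))
    (hr : ∀ t x, |r t x| ≤ Rmax) :
    ∫ x, ∑' t, γ ^ t * r t x ∂μ = ∑' t, γ ^ t * ∫ x, r t x ∂μ := by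
  have hi : ∀ t, Integrable (fun x => γ ^ t * r t x) μ := fun t =>
    (integrable_of_abs_le (hm t) (hr t)).const_mul _
  rw [← integral_tsum_of_summable_integral_norm hi]
  · simp_rw [integral_const_mul]
  · refine Summable.of_norm_bounded ((summable_geometric_of_lt_one hγ0.le hγ1).mul_left Rmax)
      fun t => ?_
    refine abs_integral_le_of_abs_le fun x => ?_
    rw [Real.norm_eq_abs, abs_abs]
    exact abs_discounted_le hγ0 (hr t x) t

/-- Removes the trajectory space. In this form the Bellman equation is an index shift, and
measurability can be checked term by term. -/
theorem Qfun_eq_tsum (hγ0 : 0 < γ) (hγ1 : γ < 1) (hr : ∀ x, |M.reward x| ≤ Rmax) (x : S × A) :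
    M.Qfun γ π x = (1 - γ) * ∑' t, γ ^ t * (stepMean M π)^[t] M.reward x := by
  rw [MDP.Qfun, integral_tsum_discounted hγ0 hγ1 
      (r := fun t (y : ℕ → S × A) => M.reward (y t))
    (fun t => M.measurable_reward.comp (measurable_pi_apply t)) (fun t y => hr _)]
  simp_rw [integral_trajLaw x _ M.measurable_reward hr]

theorem abs_Qfun_le (hγ0 : 0 < γ) (hγ1 : γ < 1) (hr : ∀ x, |M.reward x| ≤ Rmax) (x : S × A) :
    |M.Qfun γ π x| ≤ Rmax := by
  have h1 : 0 < 1 - γ := by linarith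
  rw [Qfun_eq_tsum hγ0 hγ1 hr, abs_mul, abs_of_pos h1]
  calc (1 - γ) * |∑' t, γ ^ t * (stepMean M π)^[t] M.reward x| ≤ (1 - γ) * (Rmax * (1 - γ)⁻¹) := by
        gcongr
        exact abs_tsum_discounted_le hγ0 hγ1 fun t => abs_stepMean_iterate_le hr t x
    _ = Rmax := by field_simp

theorem measurable_Qfun (hγ0 : 0 < γ) (hγ1 : γ < 1) (hr : ∀ x, |M.reward x| ≤ Rmax) :
    Measurable (M.Qfun γ π) := by
  have e : M.Qfun γ π = fun x => (1 - γ) * ∑' t, γ ^ t * (stepMean M π)^[t] M.reward x :=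
    funext fun x => Qfun_eq_tsum hγ0 hγ1 hr x
  rw [e]
  exact (Measurable.tsum fun t => (measurable_stepMean_iterate M π t).const_mul _).const_mul _

/-- The Bellman equation. -/
theorem Qfun_bellman (hγ0 : 0 < γ) (hγ1 : γ < 1) (hr : ∀ x, |M.reward x| ≤ Rmax) (x : S × A) :
    M.Qfun γ π x = (1 - γ) * M.reward x + γ * ∫ y, M.Qfun γ π y ∂(M.chain π x) := by
  simp_rw [Qfun_eq_tsum hγ0 hγ1 hr]
  rw [integral_const_mul, integral_tsum_discounted hγ0 hγ1
    (fun t => measurable_stepMean_iterate M π t) (fun t => abs_stepMean_iterate_le hr t),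
    (summable_discounted hγ0 hγ1 fun t => abs_stepMean_iterate_le hr t x).tsum_eq_zero_add,
    mul_left_comm γ, ← tsum_mul_left, mul_add]
  congr 2
  · simp
  · refine tsum_congr fun t => ?_
    rw [Function.iterate_succ', pow_succ']
    simp only [Function.comp_apply, stepMean]
    ring

end Discount

/-- After one transition the state has law `ν` again, and the chain then draws a fresh action from
`π`, so invariance passes from states to state-action pairs. -/
theorem bind_chain_stateAction {ν : Measure S} (hν : M.IsStationary π ν) :
    (stateAction ν π).bind (M.chain π) = stateAction ν π := by
  have := hν.1
  ext B hB
  have hm : Measurable fun s => π.ker s (Prod.mk s ⁻¹' B) :=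
    Kernel.measurable_kernel_prodMk_left hB
  rw [Measure.bind_apply hB (Kernel.aemeasurable _)]
  conv_rhs => rw [stateAction, Measure.compProd_apply hB, ← hν.2,
    Measure.lintegral_bind (Kernel.aemeasurable _) hm.aemeasurable]
  refine lintegral_congr fun x => ?_
  rw [MDP.chain, Kernel.compProd_apply hB]
  rfl

variable [Fintype A] [Nonempty A]

theorem measurePreserving_sampleLaw_fst {ν : Measure S} [IsProbabilityMeasure ν] :
    MeasurePreserving (fun z : Sample S A => z.1) (sampleLaw M ν π) (stateAction ν π) := by
  refine ⟨by fun_prop, ?_⟩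
  have : IsProbabilityMeasure (stateAction ν π) := by unfold stateAction; infer_instance
  exact Measure.fst_compProd _ _

theorem measurePreserving_sampleLaw_transition {ν : Measure S} [IsProbabilityMeasure ν] :
    MeasurePreserving (fun z : Sample S A => (z.1, z.2.2)) (sampleLaw M ν π)
      (stateAction ν π ⊗ₘ M.chain π) := by
  have hm : Measurable fun z : Sample S A => (z.1, z.2.2) := by fun_prop
  refine ⟨hm, ?_⟩
  have : IsProbabilityMeasure (stateAction ν π) := by unfold stateAction; infer_instance
  ext B hB
  rw [Measure.map_apply hm hB, sampleLaw, Measure.compProd_apply (hm hB),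
    Measure.compProd_apply hB]
  refine lintegral_congr fun x => ?_
  have h := Kernel.snd_prod
    ((uniformPolicy (S := S) (A := A)).ker.comap Prod.fst measurable_fst) (M.chain π)
  have h2 := congrArg (fun κ => κ x (Prod.mk x ⁻¹' B)) h
  rw [← h2, Kernel.snd_apply' _ _ (measurable_prodMk_left hB)]
  rfl

theorem measurePreserving_sampleLaw_next {ν : Measure S} (hν : M.IsStationary π ν) :
    MeasurePreserving (fun z : Sample S A => z.2.2) (sampleLaw M ν π) (stateAction ν π) := by
  have := hν.1
  have : IsProbabilityMeasure (stateAction ν π) := by unfold stateAction; infer_instance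
  have h : MeasurePreserving (Prod.snd : (S × A) × (S × A) → S × A)
      (stateAction ν π ⊗ₘ M.chain π) (stateAction ν π) :=
    ⟨measurable_snd, by
      rw [← Measure.snd, Measure.snd_compProd, bind_chain_stateAction hν]⟩
  exact h.comp measurePreserving_sampleLaw_transition

theorem isProbabilityMeasure_sampleLaw {ν : Measure S} (hν : IsProbabilityMeasure ν) :
    IsProbabilityMeasure (sampleLaw M ν π) := by
  have : IsProbabilityMeasure (stateAction ν π) := by unfold stateAction; infer_instance
  unfold sampleLaw
  infer_instance

/-- The temporal difference of the action-value function is conditionally centred. -/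
theorem integral_bellman_residual {γ Rmax : ℝ} (hγ0 : 0 < γ) (hγ1 : γ < 1)
    (hr : ∀ x, |M.reward x| ≤ Rmax) {ν : Measure S} [IsProbabilityMeasure ν]
    {u : S × A → ℝ} (hu : Measurable u) {B : ℝ} (hB : ∀ x, |u x| ≤ B) :
    ∫ z, (M.Qfun γ π z.1 - (1 - γ) * M.reward z.1 - γ * M.Qfun γ π z.2.2) * u z.1
      ∂(sampleLaw M ν π) = 0 := by
  have : IsProbabilityMeasure (stateAction ν π) := by unfold stateAction; infer_instance
  have hQ := measurable_Qfun (π := π) hγ0 hγ1 hr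
  have hM := M.measurable_reward
  have hQb := abs_Qfun_le (π := π) hγ0 hγ1 hr
  have hmp := measurePreserving_sampleLaw_transition (M := M) (π := π) (ν := ν)
  set F : (S × A) × (S × A) → ℝ := fun y =>
    (M.Qfun γ π y.1 - (1 - γ) * M.reward y.1 - γ * M.Qfun γ π y.2) * u y.1 with hF
  have hFm : Measurable F := by fun_prop
  have hFb : ∀ y, |F y| ≤ (Rmax + Rmax + Rmax) * B := by
    intro y
    rw [hF, abs_mul]
    refine mul_le_mul ?_ (hB _) (abs_nonneg _) ?_
    · have h1 := abs_le.1 (hQb y.1)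
      have h2 := abs_le.1 (hr y.1)
      have h3 := abs_le.1 (hQb y.2)
      rw [abs_le]
      constructor <;> nlinarith
    · have := (abs_nonneg _).trans (hr y.1)
      linarith
  have h1 : ∫ z, F (z.1, z.2.2) ∂(sampleLaw M ν π) = ∫ y, F y ∂(stateAction ν π ⊗ₘ M.chain π) := by
    rw [← hmp.map_eq, integral_map hmp.measurable.aemeasurable hFm.aestronglyMeasurable]
  refine h1.trans ?_
  -- Conditioning on the current pair makes `u` a constant factor, and its coefficient vanishes by
  -- the Bellman equation.
  rw [Measure.integral_compProd (integrable_of_abs_le hFm hFb)]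
  refine integral_eq_zero_of_ae (Filter.Eventually.of_forall fun x => ?_)
  have hb := Qfun_bellman (π := π) hγ0 hγ1 hr x
  have hi : Integrable (fun y => γ * M.Qfun γ π y) (M.chain π x) :=
    (integrable_of_abs_le hQ hQb).const_mul _
  simp only [hF, Pi.zero_apply]
  rw [integral_mul_const, integral_sub (integrable_const _) hi, integral_const, integral_const_mul]
  simp only [probReal_univ, one_smul]
  rw [hb]
  ring

/-! ### Measurable dependence of the action-value function on the policy parameter. -/

section Parametric

variable {H : Type*} [MeasurableSpace H] {g : H → S × A → ℝ}

/-- The policies `energyPolicy (g h)`, as a kernel in `(h, s)`. -/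
noncomputable def jointPolicy (hg : Measurable (Function.uncurry g)) : Policy (H × S) A :=
  energyPolicy (fun x : (H × S) × A => g x.1.1 (x.1.2, x.2))
    (hg.comp (by fun_prop : Measurable fun x : (H × S) × A => (x.1.1, (x.1.2, x.2))))

/-- The chains of the policies `energyPolicy (g h)`, as a kernel in `(h, x)`. -/
noncomputable def jointChain (M : MDP S A d) (hg : Measurable (Function.uncurry g)) :
    Kernel (H × (S × A)) (S × A) :=
  M.trans.comap Prod.snd measurable_snd ⊗ₖ
    (jointPolicy hg).ker.comap (fun y : (H × (S × A)) × S => (y.1.1, y.2)) (by fun_prop)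

instance (M : MDP S A d) (hg : Measurable (Function.uncurry g)) :
    IsMarkovKernel (jointChain M hg) := by
  unfold jointChain; infer_instance

theorem jointChain_apply (M : MDP S A d) (hg : Measurable (Function.uncurry g)) (h : H)
    (x : S × A) (hgh : Measurable (g h)) :
    jointChain M hg (h, x) = M.chain (energyPolicy (g h) hgh) x := by
  ext B hB
  rw [jointChain, MDP.chain, Kernel.compProd_apply hB, Kernel.compProd_apply hB]
  rfl

/-- Policies carry no σ-algebra, so joint measurability goes through the parameter. The chains form
one kernel in `(h, x)`, and each iterated mean reward is an integral of the preceding one against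
it. -/
theorem measurable_Qfun_energyPolicy {γ Rmax : ℝ} (hγ0 : 0 < γ) (hγ1 : γ < 1)
    (hr : ∀ x, |M.reward x| ≤ Rmax) (hg : Measurable (Function.uncurry g))
    (hgh : ∀ h, Measurable (g h)) :
    Measurable fun y : H × (S × A) => M.Qfun γ (energyPolicy (g y.1) (hgh y.1)) y.2 := by
  simp_rw [Qfun_eq_tsum hγ0 hγ1 hr]
  refine (Measurable.tsum fun t => Measurable.const_mul ?_ _).const_mul _
  induction t with
  | zero => exact M.measurable_reward.comp measurable_snd
  | succ t ih =>
    have hm : Measurable fun q : (H × (S × A)) × (S × A) =>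
        (stepMean M (energyPolicy (g q.1.1) (hgh q.1.1)))^[t] M.reward q.2 :=
      ih.comp (by fun_prop : Measurable fun q : (H × (S × A)) × (S × A) => (q.1.1, q.2))
    have e : (fun y : H × (S × A) =>
        (stepMean M (energyPolicy (g y.1) (hgh y.1)))^[t + 1] M.reward y.2) = fun y =>
        ∫ x, (stepMean M (energyPolicy (g y.1) (hgh y.1)))^[t] M.reward x ∂(jointChain M hg y) := by
      funext y
      rw [Function.iterate_succ', jointChain_apply M hg y.1 y.2 (hgh y.1)]
      rfl
    rw [e]
    exact (hm.stronglyMeasurable.integral_kernel_prod_right' (κ := jointChain M hg)).measurable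

end Parametric

end ValueFunction

/-! ### Joint measurability of networks, gradients and projections. -/

section Measurability

variable {m d : ℕ}

theorem measurable_nn_uncurry : Measurable fun q : ((Fin m → ℝ) × Weights m d) ×
    EuclideanSpace ℝ (Fin d) => nn q.1.1 q.1.2 q.2 := by
  unfold nn; fun_prop

theorem measurable_nnGrad_uncurry : Measurable fun q : ((Fin m → ℝ) × Weights m d) ×
    EuclideanSpace ℝ (Fin d) => nnGrad q.1.1 q.1.2 q.2 := by
  unfold nnGrad
  refine (WithLp.measurable_toLp 2 _).comp (measurable_pi_lambda _ fun i => ?_)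
  refine Measurable.smul (f := fun q : ((Fin m → ℝ) × Weights m d) × EuclideanSpace ℝ (Fin d) =>
    1 / √m * q.1.1 i * if 0 < ⟪q.1.2 i, q.2⟫ then 1 else 0) ?_ measurable_snd
  refine Measurable.mul (by fun_prop) ?_
  exact Measurable.ite (measurableSet_lt measurable_const (by fun_prop)) measurable_const
    measurable_const

theorem measurable_nnLin_uncurry : Measurable fun q : (Init m d × Weights m d) ×
    EuclideanSpace ℝ (Fin d) => nnLin q.1.1 q.1.2 q.2 := by
  have h : Measurable fun q : (Init m d × Weights m d) × EuclideanSpace ℝ (Fin d) =>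
      nnGrad q.1.1.2 q.1.1.1 q.2 := measurable_nnGrad_uncurry.comp
    (by fun_prop : Measurable fun q : (Init m d × Weights m d) × EuclideanSpace ℝ (Fin d) =>
      ((q.1.1.2, q.1.1.1), q.2))
  simp_rw [nnLin_eq_inner]
  exact h.inner (by fun_prop)

theorem measurable_projBall {Q : Type*} [MeasurableSpace Q] (R : ℝ) {c f : Q → Weights m d}
    (hc : Measurable c) (hf : Measurable f) : Measurable fun q => projBall (c q) R (f q) := by
  unfold projBall
  exact Measurable.ite (measurableSet_le (by fun_prop) (by fun_prop)) (by fun_prop) (by fun_prop)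

theorem measurable_flipFrac (v : Init m d) (ω : Weights m d) : Measurable (flipFrac v ω) := by
  unfold flipFrac
  refine (Finset.measurable_sum _ fun i _ => ?_).const_mul _
  refine Measurable.ite ?_ measurable_const measurable_const
  have h1 : MeasurableSet {x : EuclideanSpace ℝ (Fin d) | 0 < ⟪ω i, x⟫} :=
    measurableSet_lt measurable_const (by fun_prop)
  have h2 : MeasurableSet {x : EuclideanSpace ℝ (Fin d) | 0 < ⟪v.1 i, x⟫} :=
    measurableSet_lt measurable_const (by fun_prop)
  exact h1.iff h2

theorem flipFrac_le_one (v : Init m d) (ω : Weights m d) (x : EuclideanSpace ℝ (Fin d)) :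
    flipFrac v ω x ≤ 1 := by
  classical
  unfold flipFrac
  calc _ ≤ 1 / (m : ℝ) * ∑ _i : Fin m, (1 : ℝ) := by
        gcongr
        split_ifs <;> norm_num
    _ ≤ 1 := by
        simp only [Finset.sum_const, Finset.card_univ, Fintype.card_fin, nsmul_eq_mul, mul_one]
        rw [one_div, inv_mul_eq_div]
        exact div_self_le_one _

end Measurability

/-! ### The expected fraction of flipped neurons. -/

section Flip

variable {m d : ℕ} {X : Type*} [MeasurableSpace X] {σ : Measure X} [IsProbabilityMeasure σ]
  {φ : X → EuclideanSpace ℝ (Fin d)}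

/-- The pre-activation moves by at most `‖a - z‖` and has to cross zero. -/
theorem not_iff_pos_subset {a z : EuclideanSpace ℝ (Fin d)} {x : EuclideanSpace ℝ (Fin d)}
    (hx : ‖x‖ ≤ 1) (h : ¬(0 < ⟪a, x⟫ ↔ 0 < ⟪z, x⟫)) : |⟪z, x⟫| ≤ ‖a - z‖ := by
  have h1 := abs_le.1 (abs_inner_le_norm hx (a - z))
  rw [inner_sub_left] at h1
  rw [abs_le]
  by_cases h2 : 0 < ⟪z, x⟫
  · have h3 : ¬0 < ⟪a, x⟫ := by tauto
    constructor <;> linarith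
  · have h3 : 0 < ⟪a, x⟫ := by tauto
    constructor <;> linarith

theorem integral_flipFrac_le (hφ : Measurable φ) (hφ1 : ∀ x, ‖φ x‖ ≤ 1) {c : ℝ}
    (hreg : ∀ (z : EuclideanSpace ℝ (Fin d)) (ζ : ℝ), z ≠ 0 → 0 < ζ →
      σ.real {x | |⟪z, φ x⟫| ≤ ζ} ≤ c * ζ / ‖z‖)
    {v : Init m d} (hv : ∀ i, v.1 i ≠ 0) (ω : Weights m d) :
    ∫ x, flipFrac v ω (φ x) ∂σ ≤ 1 / m * ∑ i, c * ‖ω i - v.1 i‖ / ‖v.1 i‖ := by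
  classical
  unfold flipFrac
  have hms : ∀ i, MeasurableSet {x | ¬(0 < ⟪ω i, φ x⟫ ↔ 0 < ⟪v.1 i, φ x⟫)} := fun i =>
    ((measurableSet_lt measurable_const (by fun_prop)).iff
      (measurableSet_lt measurable_const (by fun_prop))).compl
  have e : ∀ i x, (if (0 < ⟪ω i, φ x⟫ ↔ 0 < ⟪v.1 i, φ x⟫) then (0 : ℝ) else 1)
      = Set.indicator {x | ¬(0 < ⟪ω i, φ x⟫ ↔ 0 < ⟪v.1 i, φ x⟫)} (fun _ => (1 : ℝ)) x := by
    intro i x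
    by_cases h : (0 < ⟪ω i, φ x⟫ ↔ 0 < ⟪v.1 i, φ x⟫) <;> simp [Set.indicator, h]
  rw [integral_const_mul]
  gcongr
  simp only [e]
  rw [integral_finsetSum _ fun i _ => (integrable_const (1 : ℝ)).indicator (hms i)]
  refine Finset.sum_le_sum fun i _ => ?_
  rw [integral_indicator_const _ (hms i), smul_eq_mul, mul_one]
  -- The regularity assumption requires a positive threshold, so neurons that have not moved are
  -- treated separately; they cannot flip.
  by_cases h0 : ω i = v.1 i
  · simp [h0]
  · have hpos : 0 < ‖ω i - v.1 i‖ := norm_pos_iff.2 (sub_ne_zero.2 h0)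
    exact (measureReal_mono fun x hx => not_iff_pos_subset (hφ1 x) hx).trans
      (hreg _ _ (hv i) hpos)

/-- The bound for the expected fraction of flipped neurons in the ball of radius `R`. -/
noncomputable def flipBound (c R : ℝ) (v : Init m d) : ℝ :=
  c * R / (2 * √m) * (1 + (∑ i, 1 / ‖v.1 i‖ ^ 2) / m)

theorem flipBound_nonneg {c R : ℝ} (hc : 0 < c) (hR : 0 < R) (v : Init m d) :
    0 ≤ flipBound c R v := by
  unfold flipBound; positivity

theorem integral_flipFrac_le_flipBound (hm : 0 < m) (hφ : Measurable φ) (hφ1 : ∀ x, ‖φ x‖ ≤ 1)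
    {c R : ℝ} (hc : 0 < c) (hR : 0 < R)
    (hreg : ∀ (z : EuclideanSpace ℝ (Fin d)) (ζ : ℝ), z ≠ 0 → 0 < ζ →
      σ.real {x | |⟪z, φ x⟫| ≤ ζ} ≤ c * ζ / ‖z‖)
    {v : Init m d} (hv : ∀ i, v.1 i ≠ 0) {ω : Weights m d} (hω : ‖ω - v.1‖ ≤ R) :
    ∫ x, flipFrac v ω (φ x) ∂σ ≤ flipBound c R v := by
  refine (integral_flipFrac_le hφ hφ1 hreg hv ω).trans ?_
  have hm' : (0 : ℝ) < m := by exact_mod_cast hm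
  set q := √(m : ℝ) with hq
  have hq0 : 0 < q := Real.sqrt_pos.2 hm'
  have hqm : (m : ℝ) = q ^ 2 := (Real.sq_sqrt hm'.le).symm
  have h1 : ∑ i, ‖ω i - v.1 i‖ ^ 2 ≤ R ^ 2 := by
    have h2 : ‖ω - v.1‖ ^ 2 ≤ R ^ 2 := by gcongr
    rwa [PiLp.norm_sq_eq_of_L2] at h2
  -- Young's inequality separates the displacements, whose squares sum to at most `R²`, from the
  -- initial norms. The weight `√m / R` balances the two parts and removes `ω` from the bound.
  have h2 : ∑ i, c * ‖ω i - v.1 i‖ / ‖v.1 i‖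
      ≤ ∑ i, c * (q / (2 * R) * ‖ω i - v.1 i‖ ^ 2 + R / (2 * q) * (1 / ‖v.1 i‖ ^ 2)) := by
    refine Finset.sum_le_sum fun i _ => ?_
    rw [mul_div_assoc]
    refine mul_le_mul_of_nonneg_left ?_ hc.le
    generalize ‖ω i - v.1 i‖ = y
    rw [← one_div_pow, div_eq_mul_one_div]
    generalize 1 / ‖v.1 i‖ = a
    have h3 : q / (2 * R) * y ^ 2 + R / (2 * q) * a ^ 2 - y * a
        = (q * y - R * a) ^ 2 / (2 * R * q) := by
      field_simp
      ring
    have h4 : 0 ≤ (q * y - R * a) ^ 2 / (2 * R * q) := by positivity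
    linarith
  rw [← Finset.mul_sum, Finset.sum_add_distrib, ← Finset.mul_sum, ← Finset.mul_sum] at h2
  calc 1 / (m : ℝ) * ∑ i, c * ‖ω i - v.1 i‖ / ‖v.1 i‖
      ≤ 1 / (m : ℝ) * (c * (q / (2 * R) * R ^ 2 + R / (2 * q) * ∑ i, 1 / ‖v.1 i‖ ^ 2)) := by
        gcongr
        refine h2.trans ?_
        gcongr
    _ = flipBound c R v := by
        rw [flipBound, ← hq, hqm]
        field_simp

/-- The elementary bound `√f ≤ (l + f/l)/2` replaces Jensen's inequality. The result is affine in
`h`, so the later expectation over the initialization needs only the mean of `flipBound`. -/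
theorem integral_sqrt_flipFrac_le (hφ : Measurable φ) {v : Init m d} {ω : Weights m d} {h l : ℝ}
    (hl : 0 < l) (hh : ∫ x, flipFrac v ω (φ x) ∂σ ≤ h) :
    ∫ x, √(flipFrac v ω (φ x)) ∂σ ≤ (l + h / l) / 2 := by
  have hm := (measurable_flipFrac v ω).comp hφ
  have hi : Integrable (fun x => flipFrac v ω (φ x)) σ :=
    integrable_of_abs_le (B := 1) hm fun x => by
      rw [abs_of_nonneg (flipFrac_nonneg _ _ _)]; exact flipFrac_le_one _ _ _
  calc ∫ x, √(flipFrac v ω (φ x)) ∂σ ≤ ∫ x, (l / 2 + 1 / (2 * l) * flipFrac v ω (φ x)) ∂σ := by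
        refine integral_mono_of_nonneg (Filter.Eventually.of_forall fun x => Real.sqrt_nonneg _)
          ((integrable_const _).add (hi.const_mul _)) (Filter.Eventually.of_forall fun x => ?_)
        beta_reduce
        have h1 := Real.sq_sqrt (flipFrac_nonneg v ω (φ x))
        generalize √(flipFrac v ω (φ x)) = y at h1 ⊢
        rw [← h1]
        have h3 : l / 2 + 1 / (2 * l) * y ^ 2 - y = (l - y) ^ 2 / (2 * l) := by
          field_simp
          ring
        have h4 : 0 ≤ (l - y) ^ 2 / (2 * l) := by positivity
        linarith
    _ = l / 2 + 1 / (2 * l) * ∫ x, flipFrac v ω (φ x) ∂σ := by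
        rw [integral_add (integrable_const _) (hi.const_mul _), integral_const_mul]
        simp
    _ ≤ l / 2 + 1 / (2 * l) * h := by gcongr
    _ = _ := by field_simp

end Flip

/-! ### The drift of one TD update. -/

section TDStep

variable {S A : Type*} [MeasurableSpace S] [MeasurableSpace A]
  {d : ℕ} {M : MDP S A d} {π : Policy S A} {γ Rmax : ℝ} {p : Params} {v : Init p.m d}
  {β ω : Weights p.m d} {ν : Measure S}

theorem abs_nn_le_of_Qfun (hγ0 : 0 < γ) (hγ1 : γ < 1) (hfeat : ∀ x, ‖M.feat x‖ ≤ 1)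
    (hr : ∀ x, |M.reward x| ≤ Rmax) (hb : ∀ i, |v.2 i| = 1) (hβ : ‖β - v.1‖ ≤ p.RQ)
    (hQ : ∀ x, M.Qfun γ π x = nnLin v β (M.feat x)) (hω : ‖ω - v.1‖ ≤ p.RQ) (x : S × A) :
    |nn v.2 ω (M.feat x)| ≤ Rmax + 2 * p.RQ :=
  abs_nn_le hb hω hβ (hfeat x) (by rw [← hQ]; exact abs_Qfun_le hγ0 hγ1 hr x)

theorem norm_sub_le_two_mul {c : Weights p.m d} {R : ℝ} (hω : ‖ω - c‖ ≤ R) (hβ : ‖β - c‖ ≤ R) :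
    ‖ω - β‖ ≤ 2 * R := by
  have h : ω - β = (ω - c) - (β - c) := by abel
  rw [h]
  exact (norm_sub_le _ _).trans (by linarith)

theorem abs_tdError_le {n n' r B : ℝ} (hγ0 : 0 < γ) (hγ1 : γ < 1) (hn : |n| ≤ B) (hn' : |n'| ≤ B)
    (hr : |r| ≤ Rmax) : |n - (1 - γ) * r - γ * n'| ≤ Rmax + 2 * B := by
  have hB : 0 ≤ B := (abs_nonneg _).trans hn
  have hRm : 0 ≤ Rmax := (abs_nonneg _).trans hr
  have h1 : |(1 - γ) * r| ≤ Rmax := by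
    rw [abs_mul, abs_of_pos (by linarith)]
    nlinarith [abs_nonneg r]
  have h2 : |γ * n'| ≤ B := by
    rw [abs_mul, abs_of_pos hγ0]
    nlinarith [abs_nonneg n']
  rw [abs_le] at *
  constructor <;> linarith

/-- The inner product of the stochastic TD direction with `ω - β`, compared with that of its
linearization. -/
theorem le_tdError_mul_inner {R G u u' q q' δ g n n' l l' Q Q' r : ℝ}
    (hγ0 : 0 < γ) (hγ1 : γ < 1) (hR : 0 ≤ R) (hq : 0 ≤ q) (hq' : 0 ≤ q')
    (hδ : δ = n - (1 - γ) * r - γ * n') (hδG : |δ| ≤ G) (hg : |g - u| ≤ 2 * R * q)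
    (hl : |n - l| ≤ R * q) (hl' : |n' - l'| ≤ R * q') (hub : |u| ≤ 2 * R)
    (hu : l = u + Q) (hu' : l' = u' + Q') :
    (1 - γ / 2) * u ^ 2 - γ / 2 * u' ^ 2 + (Q - (1 - γ) * r - γ * Q') * u
        - ((2 * R ^ 2 + 2 * R * G) * q + 2 * R ^ 2 * q') ≤ δ * g := by
  have hG0 : 0 ≤ G := (abs_nonneg _).trans hδG
  have e1 : -(G * (2 * R * q)) ≤ δ * (g - u) := by
    have h2 := mul_le_mul hδG hg (abs_nonneg _) hG0
    rw [← abs_mul] at h2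
    exact (abs_le.1 h2).1
  have e2 : -(R * q * (2 * R)) ≤ (n - l) * u := by
    have h2 := mul_le_mul hl hub (abs_nonneg _) (by positivity)
    rw [← abs_mul] at h2
    exact (abs_le.1 h2).1
  have e3 : γ * ((n' - l') * u) ≤ R * q' * (2 * R) := by
    have h2 := mul_le_mul hl' hub (abs_nonneg _) (by positivity)
    rw [← abs_mul] at h2
    have h3 := (abs_le.1 h2).2
    have h4 : 0 ≤ R * q' * (2 * R) := by positivity
    exact (mul_le_mul_of_nonneg_left h3 hγ0.le).trans (mul_le_of_le_one_left h4 hγ1.le)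
  have e4 : 0 ≤ γ / 2 * (u - u') ^ 2 := by positivity
  -- The first three terms are the gradient error and the two network errors, bounded by `e1`, `e2`,
  -- `e3`. The last is the exact linearized TD direction, whose cross term `u u'` is handled by
  -- completing the square.
  have e5 : δ * g = δ * (g - u) + (n - l) * u - γ * ((n' - l') * u)
      + (u ^ 2 - γ * (u * u') + (Q - (1 - γ) * r - γ * Q') * u) := by
    rw [hδ, hu, hu']; ring
  have e6 : u ^ 2 - γ * (u * u') = (1 - γ / 2) * u ^ 2 - γ / 2 * u' ^ 2 + γ / 2 * (u - u') ^ 2 := by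
    ring
  rw [e5, e6]
  calc _ = -(G * (2 * R * q)) + -(R * q * (2 * R)) - R * q' * (2 * R)
        + ((1 - γ / 2) * u ^ 2 - γ / 2 * u' ^ 2 + 0 + (Q - (1 - γ) * r - γ * Q') * u) := by ring
    _ ≤ _ := by gcongr

theorem integral_affine_combination {X : Type*} [MeasurableSpace X] {ρ : Measure X}
    [IsProbabilityMeasure ρ] {f₁ f₂ f₃ f₄ f₅ : X → ℝ} (h₁ : Integrable f₁ ρ)
    (h₂ : Integrable f₂ ρ) (h₃ : Integrable f₃ ρ) (h₄ : Integrable f₄ ρ) (h₅ : Integrable f₅ ρ)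
    (N e c₁ c₂ c₃ c₄ k : ℝ) :
    Integrable (fun z => N - e * (c₁ * f₁ z - c₂ * f₂ z + f₅ z) + e * (c₃ * f₃ z + c₄ * f₄ z) + k)
        ρ ∧
      ∫ z, (N - e * (c₁ * f₁ z - c₂ * f₂ z + f₅ z) + e * (c₃ * f₃ z + c₄ * f₄ z) + k) ∂ρ
        = N - e * (c₁ * ∫ z, f₁ z ∂ρ - c₂ * ∫ z, f₂ z ∂ρ + ∫ z, f₅ z ∂ρ)
          + e * (c₃ * ∫ z, f₃ z ∂ρ + c₄ * ∫ z, f₄ z ∂ρ) + k := by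
  have j0 : Integrable (fun z => c₁ * f₁ z - c₂ * f₂ z) ρ := (h₁.const_mul _).sub (h₂.const_mul _)
  have j1 : Integrable (fun z => c₁ * f₁ z - c₂ * f₂ z + f₅ z) ρ := j0.add h₅
  have j2 : Integrable (fun z => c₃ * f₃ z + c₄ * f₄ z) ρ := (h₃.const_mul _).add (h₄.const_mul _)
  have j3 : Integrable (fun z => N - e * (c₁ * f₁ z - c₂ * f₂ z + f₅ z)) ρ :=
    (integrable_const _).sub (j1.const_mul _)
  have j4 : Integrable (fun z => N - e * (c₁ * f₁ z - c₂ * f₂ z + f₅ z)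
      + e * (c₃ * f₃ z + c₄ * f₄ z)) ρ := j3.add (j2.const_mul _)
  refine ⟨j4.add (integrable_const _), ?_⟩
  rw [integral_add j4 (integrable_const _), integral_add j3 (j2.const_mul _),
    integral_sub (integrable_const _) (j1.const_mul _), integral_const_mul, integral_const_mul,
    integral_add j0 h₅, integral_sub (h₁.const_mul _) (h₂.const_mul _),
    integral_add (h₃.const_mul _) (h₄.const_mul _)]
  simp only [integral_const_mul, integral_const, probReal_univ, one_smul]

/-- One TD update, pointwise in the sample. -/
theorem norm_tdStep_sub_sq_le (hγ0 : 0 < γ) (hγ1 : γ < 1) (hfeat : ∀ x, ‖M.feat x‖ ≤ 1)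
    (hr : ∀ x, |M.reward x| ≤ Rmax) (hb : ∀ i, |v.2 i| = 1) (hβ : ‖β - v.1‖ ≤ p.RQ)
    (hQ : ∀ x, M.Qfun γ π x = nnLin v β (M.feat x)) (hω : ‖ω - v.1‖ ≤ p.RQ)
    (hη : 0 ≤ p.stepsize) {G : ℝ} (hG : 3 * Rmax + 4 * p.RQ ≤ G) {u q : S × A → ℝ}
    (hu : u = fun x => nnLin v ω (M.feat x) - M.Qfun γ π x)
    (hq : q = fun x => √(flipFrac v ω (M.feat x))) (z : Sample S A) :
    ‖tdStep M γ p v ω z - β‖ ^ 2 ≤ ‖ω - β‖ ^ 2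
      - 2 * p.stepsize * ((1 - γ / 2) * u z.1 ^ 2 - γ / 2 * u z.2.2 ^ 2
        + (M.Qfun γ π z.1 - (1 - γ) * M.reward z.1 - γ * M.Qfun γ π z.2.2) * u z.1)
      + 2 * p.stepsize * ((2 * p.RQ ^ 2 + 2 * p.RQ * G) * q z.1 + 2 * p.RQ ^ 2 * q z.2.2)
      + p.stepsize ^ 2 * G ^ 2 := by
  have hR : 0 ≤ p.RQ := (norm_nonneg _).trans hβ
  have hx := abs_nn_le_of_Qfun hγ0 hγ1 hfeat hr hb hβ hQ hω z.1
  have hx' := abs_nn_le_of_Qfun hγ0 hγ1 hfeat hr hb hβ hQ hω z.2.2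
  have hrx := hr z.1
  have hωβ : ‖ω - β‖ ≤ 2 * p.RQ := norm_sub_le_two_mul hω hβ
  have hux : u z.1 = ⟪nnGrad v.2 v.1 (M.feat z.1), ω - β⟫ := by
    rw [hu]; simp only; rw [hQ, nnLin_sub]
  have hub : |u z.1| ≤ 2 * p.RQ := by
    rw [hux]; exact (abs_inner_nnGrad_le hb _ _ (hfeat _)).trans hωβ
  have hl : |nn v.2 ω (M.feat z.1) - nnLin v ω (M.feat z.1)| ≤ p.RQ * q z.1 := by
    rw [hq]; exact (abs_nn_sub_nnLin_le hb ω (hfeat _)).trans (by gcongr)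
  have hl' : |nn v.2 ω (M.feat z.2.2) - nnLin v ω (M.feat z.2.2)| ≤ p.RQ * q z.2.2 := by
    rw [hq]; exact (abs_nn_sub_nnLin_le hb ω (hfeat _)).trans (by gcongr)
  have hg : |⟪nnGrad v.2 ω (M.feat z.1), ω - β⟫ - u z.1| ≤ 2 * p.RQ * q z.1 := by
    rw [hux, hq]; exact (abs_inner_nnGrad_sub_le hb ω _ (hfeat _)).trans (by gcongr)
  have hux0 : nnLin v ω (M.feat z.1) = u z.1 + M.Qfun γ π z.1 := by rw [hu]; ring
  have hux1 : nnLin v ω (M.feat z.2.2) = u z.2.2 + M.Qfun γ π z.2.2 := by rw [hu]; ring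
  have hq0 : 0 ≤ q z.1 := by rw [hq]; positivity
  have hq1 : 0 ≤ q z.2.2 := by rw [hq]; positivity
  have hgn := norm_nnGrad_le hb ω (hfeat z.1)
  set δ := nn v.2 ω (M.feat z.1) - (1 - γ) * M.reward z.1 - γ * nn v.2 ω (M.feat z.2.2) with hδ
  have hδG : |δ| ≤ G := (abs_tdError_le hγ0 hγ1 hx hx' hrx).trans (by linarith)
  have hG0 : 0 ≤ G := (abs_nonneg _).trans hδG
  have step1 : ‖tdStep M γ p v ω z - β‖ ^ 2
      ≤ ‖ω - β‖ ^ 2 - 2 * p.stepsize * (δ * ⟪nnGrad v.2 ω (M.feat z.1), ω - β⟫)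
        + p.stepsize ^ 2 * G ^ 2 := by
    have h1 : ‖tdStep M γ p v ω z - β‖
        ≤ ‖(ω - β) - (p.stepsize * δ) • nnGrad v.2 ω (M.feat z.1)‖ := by
      refine (norm_projBall_sub_le hβ _).trans_eq ?_
      congr 1
      abel
    calc ‖tdStep M γ p v ω z - β‖ ^ 2
        ≤ ‖(ω - β) - (p.stepsize * δ) • nnGrad v.2 ω (M.feat z.1)‖ ^ 2 := by gcongr
      _ = ‖ω - β‖ ^ 2 - 2 * p.stepsize * (δ * ⟪nnGrad v.2 ω (M.feat z.1), ω - β⟫)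
          + p.stepsize ^ 2 * (|δ| ^ 2 * ‖nnGrad v.2 ω (M.feat z.1)‖ ^ 2) := by
          rw [norm_sub_sq_real, norm_smul, real_inner_smul_right, real_inner_comm,
            Real.norm_eq_abs, mul_pow, sq_abs, sq_abs]
          ring
      _ ≤ ‖ω - β‖ ^ 2 - 2 * p.stepsize * (δ * ⟪nnGrad v.2 ω (M.feat z.1), ω - β⟫)
          + p.stepsize ^ 2 * (G ^ 2 * 1 ^ 2) := by gcongr
      _ = _ := by ring
  have key := le_tdError_mul_inner hγ0 hγ1 hR hq0 hq1 hδ hδG hg hl hl' hub hux0 hux1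
  have := mul_le_mul_of_nonneg_left key (by positivity : 0 ≤ 2 * p.stepsize)
  linarith

variable [Fintype A] [Nonempty A]

/-- One TD update in expectation. -/
theorem lintegral_norm_tdStep_sub_sq_le (hγ0 : 0 < γ) (hγ1 : γ < 1)
    (hfeat : ∀ x, ‖M.feat x‖ ≤ 1)
    (hr : ∀ x, |M.reward x| ≤ Rmax) (hb : ∀ i, |v.2 i| = 1) (hβ : ‖β - v.1‖ ≤ p.RQ)
    (hQ : ∀ x, M.Qfun γ π x = nnLin v β (M.feat x)) (hω : ‖ω - v.1‖ ≤ p.RQ)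
    (hη : 0 ≤ p.stepsize) {G : ℝ} (hG : 3 * Rmax + 4 * p.RQ ≤ G)
    (hν : M.IsStationary π ν) {s : ℝ}
    (hs : ∫ x, √(flipFrac v ω (M.feat x)) ∂(stateAction ν π) ≤ s) :
    ∫⁻ z, ENNReal.ofReal (‖tdStep M γ p v ω z - β‖ ^ 2) ∂(sampleLaw M ν π)
      + ENNReal.ofReal (2 * p.stepsize * (1 - γ)) *
        ∫⁻ x, ENNReal.ofReal ((nnLin v ω (M.feat x) - M.Qfun γ π x) ^ 2) ∂(stateAction ν π)
      ≤ ENNReal.ofReal (‖ω - β‖ ^ 2)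
        + ENNReal.ofReal (2 * p.stepsize * ((4 * p.RQ ^ 2 + 2 * p.RQ * G) * s)
          + p.stepsize ^ 2 * G ^ 2) := by
  have hR : 0 ≤ p.RQ := (norm_nonneg _).trans hβ
  have := hν.1
  have hσ : IsProbabilityMeasure (stateAction ν π) := by unfold stateAction; infer_instance
  have hρ : IsProbabilityMeasure (sampleLaw M ν π) := isProbabilityMeasure_sampleLaw hν.1
  have hRm : 0 ≤ Rmax := by
    obtain ⟨x⟩ : Nonempty (S × A) := nonempty_of_isProbabilityMeasure (stateAction ν π)
    exact (abs_nonneg _).trans (hr x)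
  have hG0 : 0 ≤ G := by linarith
  have hMf := M.measurable_feat
  have hMr := M.measurable_reward
  have hQm := measurable_Qfun (π := π) hγ0 hγ1 hr
  set u : S × A → ℝ := fun x => nnLin v ω (M.feat x) - M.Qfun γ π x with hu
  set q : S × A → ℝ := fun x => √(flipFrac v ω (M.feat x)) with hq
  have hum : Measurable u :=
    (measurable_nnLin_uncurry.comp
      (by fun_prop : Measurable fun x : S × A => ((v, ω), M.feat x))).sub hQm
  have hqm : Measurable q := ((measurable_flipFrac v ω).comp hMf).sqrt
  have hub : ∀ x, |u x| ≤ 2 * p.RQ := fun x => by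
    rw [hu]; simp only; rw [hQ, nnLin_sub]
    exact (abs_inner_nnGrad_le hb _ _ (hfeat _)).trans (norm_sub_le_two_mul hω hβ)
  have hqb : ∀ x, |q x| ≤ 1 := fun x => by
    rw [hq, abs_of_nonneg (Real.sqrt_nonneg _), Real.sqrt_le_left zero_le_one, one_pow]
    exact flipFrac_le_one _ _ _
  have mp1 := measurePreserving_sampleLaw_fst (M := M) (π := π) (ν := ν)
  have mp2 := measurePreserving_sampleLaw_next hν
  have tr1 : ∀ f : S × A → ℝ, Measurable f →
      ∫ z, f z.1 ∂(sampleLaw M ν π) = ∫ x, f x ∂(stateAction ν π) := fun f hf => by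
    rw [← mp1.map_eq, integral_map mp1.measurable.aemeasurable hf.aestronglyMeasurable]
  have tr2 : ∀ f : S × A → ℝ, Measurable f →
      ∫ z, f z.2.2 ∂(sampleLaw M ν π) = ∫ x, f x ∂(stateAction ν π) := fun f hf => by
    rw [← mp2.map_eq, integral_map mp2.measurable.aemeasurable hf.aestronglyMeasurable]
  have hu2 : ∀ x, |u x ^ 2| ≤ (2 * p.RQ) ^ 2 := fun x => by
    rw [abs_pow]; exact pow_le_pow_left₀ (abs_nonneg _) (hub x) 2
  have hres := integral_bellman_residual (M := M) (π := π) (ν := ν) hγ0 hγ1 hr hum hub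
  set U := ∫ x, u x ^ 2 ∂(stateAction ν π) with hU
  have i1 : Integrable (fun z : Sample S A => u z.1 ^ 2) (sampleLaw M ν π) :=
    integrable_of_abs_le (by fun_prop) fun z => hu2 z.1
  have i2 : Integrable (fun z : Sample S A => u z.2.2 ^ 2) (sampleLaw M ν π) :=
    integrable_of_abs_le (by fun_prop) fun z => hu2 z.2.2
  have i3 : Integrable (fun z : Sample S A => q z.1) (sampleLaw M ν π) :=
    integrable_of_abs_le (by fun_prop) fun z => hqb z.1
  have i4 : Integrable (fun z : Sample S A => q z.2.2) (sampleLaw M ν π) :=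
    integrable_of_abs_le (by fun_prop) fun z => hqb z.2.2
  have i5 : Integrable (fun z : Sample S A =>
      (M.Qfun γ π z.1 - (1 - γ) * M.reward z.1 - γ * M.Qfun γ π z.2.2) * u z.1)
      (sampleLaw M ν π) := by
    refine integrable_of_abs_le (B := (Rmax + Rmax + Rmax) * (2 * p.RQ)) (by fun_prop) fun z => ?_
    rw [abs_mul]
    refine mul_le_mul ?_ (hub _) (abs_nonneg _) (by linarith)
    have h1 := abs_le.1 (abs_Qfun_le (π := π) hγ0 hγ1 hr z.1)
    have h2 := abs_le.1 (hr z.1)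
    have h3 := abs_le.1 (abs_Qfun_le (π := π) hγ0 hγ1 hr z.2.2)
    rw [abs_le]
    constructor <;> nlinarith
  obtain ⟨hFi, hFint⟩ := integral_affine_combination i1 i2 i3 i4 i5 (‖ω - β‖ ^ 2)
    (2 * p.stepsize) (1 - γ / 2) (γ / 2) (2 * p.RQ ^ 2 + 2 * p.RQ * G) (2 * p.RQ ^ 2)
    (p.stepsize ^ 2 * G ^ 2)
  -- Stationarity gives `u` and `u'` the same second moment, so the coefficients `1 - γ/2` and
  -- `-γ/2` combine to the contraction factor `1 - γ`.
  rw [hres, tr1 (fun x => u x ^ 2) (by fun_prop), tr2 (fun x => u x ^ 2) (by fun_prop),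
    tr1 q hqm, tr2 q hqm] at hFint
  set F : Sample S A → ℝ := fun z => ‖ω - β‖ ^ 2
      - 2 * p.stepsize * ((1 - γ / 2) * u z.1 ^ 2 - γ / 2 * u z.2.2 ^ 2
        + (M.Qfun γ π z.1 - (1 - γ) * M.reward z.1 - γ * M.Qfun γ π z.2.2) * u z.1)
      + 2 * p.stepsize * ((2 * p.RQ ^ 2 + 2 * p.RQ * G) * q z.1 + 2 * p.RQ ^ 2 * q z.2.2)
      + p.stepsize ^ 2 * G ^ 2 with hF
  have hpt : ∀ z, ‖tdStep M γ p v ω z - β‖ ^ 2 ≤ F z := fun z =>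
    norm_tdStep_sub_sq_le hγ0 hγ1 hfeat hr hb hβ hQ hω hη hG hu hq z
  -- Because `F` dominates a square, `ENNReal.ofReal` loses nothing when its integral is evaluated.
  have hF0 : ∀ z, 0 ≤ F z := fun z => (by positivity : (0 : ℝ) ≤ _).trans (hpt z)
  have hUl : ∫⁻ x, ENNReal.ofReal (u x ^ 2) ∂(stateAction ν π) = ENNReal.ofReal U :=
    (ofReal_integral_eq_lintegral_ofReal (integrable_of_abs_le (by fun_prop) hu2)
      (Filter.Eventually.of_forall fun x => sq_nonneg _)).symm
  have hU0 : 0 ≤ U := integral_nonneg fun x => sq_nonneg _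
  have h1γ : 0 ≤ 1 - γ := by linarith
  have hs0 : 0 ≤ s := (integral_nonneg fun x => Real.sqrt_nonneg _).trans hs
  have hint0 : 0 ≤ ∫ z, F z ∂(sampleLaw M ν π) := integral_nonneg hF0
  calc _ ≤ ∫⁻ z, ENNReal.ofReal (F z) ∂(sampleLaw M ν π)
        + ENNReal.ofReal (2 * p.stepsize * (1 - γ)) *
          ∫⁻ x, ENNReal.ofReal (u x ^ 2) ∂(stateAction ν π) := by
        gcongr with z
        exact hpt z
    _ = ENNReal.ofReal (∫ z, F z ∂(sampleLaw M ν π) + 2 * p.stepsize * (1 - γ) * U) := by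
        rw [hUl, ← ofReal_integral_eq_lintegral_ofReal hFi (Filter.Eventually.of_forall hF0),
          ← ENNReal.ofReal_mul (by positivity), ENNReal.ofReal_add hint0 (by positivity)]
    _ ≤ ENNReal.ofReal (‖ω - β‖ ^ 2 + (2 * p.stepsize * ((4 * p.RQ ^ 2 + 2 * p.RQ * G) * s)
          + p.stepsize ^ 2 * G ^ 2)) := by
        refine ENNReal.ofReal_le_ofReal ?_
        rw [hFint]
        have : 2 * p.stepsize * ((4 * p.RQ ^ 2 + 2 * p.RQ * G) * ∫ x, q x ∂(stateAction ν π))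
            ≤ 2 * p.stepsize * ((4 * p.RQ ^ 2 + 2 * p.RQ * G) * s) := by gcongr
        linarith
    _ = _ := ENNReal.ofReal_add (by positivity) (by positivity)

end TDStep

/-! ### Iterates driven by an i.i.d. sample. -/

section Iteration

variable {W X : Type*} {T : ℕ}

/-- The iterate at time `t` reads only the sample points with index below `t`, so point `i` is still
fresh at time `i`. -/
theorem iterates_update_of_le {step : W → X → W} {w₀ : W} (D : Fin T → X) (i : Fin T) (z : X)
    {t : ℕ} (ht : t ≤ i) : iterates step w₀ (Function.update D i z) t = iterates step w₀ D t := by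
  induction t with
  | zero => rfl
  | succ t ih =>
    have hT : t < T := by omega
    have hne : (⟨t, hT⟩ : Fin T) ≠ i := fun h => by
      have := congrArg Fin.val h
      simp only at this
      omega
    simp only [iterates, hT, dif_pos, ih (by omega), Function.update_of_ne hne]

theorem iterates_mem {step : W → X → W} {w₀ : W} {B : Set W} (h₀ : w₀ ∈ B)
    (hB : ∀ w z, step w z ∈ B) (D : Fin T → X) (t : ℕ) : iterates step w₀ D t ∈ B := by
  induction t with
  | zero => exact h₀
  | succ t ih =>
    simp only [iterates]
    split_ifs
    · exact hB _ _
    · exact ih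

variable [MeasurableSpace W] [MeasurableSpace X]

theorem measurable_iterates {H : Type*} [MeasurableSpace H] {step : H → W → X → W} {w₀ : H → W}
    (hstep : Measurable fun q : H × W × X => step q.1 q.2.1 q.2.2) (hw₀ : Measurable w₀) (t : ℕ) :
    Measurable fun q : H × (Fin T → X) => iterates (step q.1) (w₀ q.1) q.2 t := by
  induction t with
  | zero => exact hw₀.comp measurable_fst
  | succ t ih =>
    by_cases h : t < T
    · simp only [iterates, h, dif_pos]
      exact hstep.comp (measurable_fst.prodMk (ih.prodMk
        ((measurable_pi_apply _).comp measurable_snd)))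
    · simpa only [iterates, h, dif_neg, not_false_eq_true] using ih

/-- Resampling one coordinate preserves the product law. This takes the place of conditioning on the
past of the inner loop. -/
theorem lintegral_pi_eq_lintegral_update {ρ : Measure X} [IsProbabilityMeasure ρ]
    {f : (Fin T → X) → ℝ≥0∞} (hf : Measurable f) (i : Fin T) :
    ∫⁻ D, f D ∂(Measure.pi fun _ : Fin T => ρ)
      = ∫⁻ D, ∫⁻ z, f (Function.update D i z) ∂ρ ∂(Measure.pi fun _ : Fin T => ρ) := by
  have hg : Measurable (lmarginal (fun _ : Fin T => ρ) {i} f) := hf.lmarginal _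
  have h := lintegral_eq_of_lmarginal_eq (μ := fun _ : Fin T => ρ) {i} hf hg (by
    ext D
    rw [lmarginal_singleton _ i]
    simp only
    rw [lmarginal_singleton _ i]
    simp)
  rw [h]
  simp_rw [lmarginal_singleton]

/-- Telescoping a drift inequality along the iterates driven by an i.i.d. sample. -/
theorem sum_lintegral_iterates_le {ρ : Measure X} [IsProbabilityMeasure ρ] {step : W → X → W}
    {w₀ : W} (hstep : Measurable (Function.uncurry step)) {V e : W → ℝ≥0∞} (hV : Measurable V)
    (he : Measurable e) {B : Set W} (h₀ : w₀ ∈ B) (hB : ∀ w z, step w z ∈ B) {κ : ℝ≥0∞}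
    (hdrift : ∀ w ∈ B, ∫⁻ z, V (step w z) ∂ρ + e w ≤ V w + κ) :
    ∑ t ∈ Finset.range T, ∫⁻ D, e (iterates step w₀ D t) ∂(Measure.pi fun _ : Fin T => ρ)
      ≤ V w₀ + T * κ := by
  have hm : ∀ t, Measurable fun D : Fin T → X => iterates step w₀ D t := fun t =>
    (measurable_iterates (H := Unit) (step := fun _ => step) (w₀ := fun _ => w₀)
      (hstep.comp measurable_snd) measurable_const t).comp (measurable_prodMk_left (x := ()))
  have key : ∀ t ≤ T, ∫⁻ D, V (iterates step w₀ D t) ∂(Measure.pi fun _ : Fin T => ρ)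
      + ∑ s ∈ Finset.range t, ∫⁻ D, e (iterates step w₀ D s) ∂(Measure.pi fun _ : Fin T => ρ)
      ≤ V w₀ + t * κ := by
    intro t
    induction t with
    | zero => intro _; simp [iterates]
    | succ t ih =>
      intro ht
      have hT : t < T := ht
      have h1 : ∫⁻ D, V (iterates step w₀ D (t + 1)) ∂(Measure.pi fun _ : Fin T => ρ)
          = ∫⁻ D, ∫⁻ z, V (step (iterates step w₀ D t) z) ∂ρ
            ∂(Measure.pi fun _ : Fin T => ρ) := by
        rw [lintegral_pi_eq_lintegral_update
          (f := fun D => V (iterates step w₀ D (t + 1))) (hV.comp (hm (t + 1))) ⟨t, hT⟩]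
        refine lintegral_congr fun D => lintegral_congr fun z => ?_
        simp only [iterates, hT, dif_pos, Function.update_self,
          iterates_update_of_le D ⟨t, hT⟩ z le_rfl]
      have h2 : ∫⁻ D, ∫⁻ z, V (step (iterates step w₀ D t) z) ∂ρ
            ∂(Measure.pi fun _ : Fin T => ρ)
          + ∫⁻ D, e (iterates step w₀ D t) ∂(Measure.pi fun _ : Fin T => ρ)
          ≤ ∫⁻ D, V (iterates step w₀ D t) ∂(Measure.pi fun _ : Fin T => ρ) + κ := by
        rw [← lintegral_add_right _
          (show Measurable fun D : Fin T → X => e (iterates step w₀ D t) from he.comp (hm t))]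
        calc _ ≤ ∫⁻ D, (V (iterates step w₀ D t) + κ) ∂(Measure.pi fun _ : Fin T => ρ) :=
              lintegral_mono fun D => hdrift _ (iterates_mem h₀ hB D t)
          _ = _ := by rw [lintegral_add_right _ measurable_const]; simp
      rw [Finset.sum_range_succ, h1]
      calc _ = (∫⁻ D, ∫⁻ z, V (step (iterates step w₀ D t) z) ∂ρ
            ∂(Measure.pi fun _ : Fin T => ρ)
          + ∫⁻ D, e (iterates step w₀ D t) ∂(Measure.pi fun _ : Fin T => ρ))
          + ∑ s ∈ Finset.range t, ∫⁻ D, e (iterates step w₀ D s)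
            ∂(Measure.pi fun _ : Fin T => ρ) := by ring
        _ ≤ (∫⁻ D, V (iterates step w₀ D t) ∂(Measure.pi fun _ : Fin T => ρ) + κ)
          + ∑ s ∈ Finset.range t, ∫⁻ D, e (iterates step w₀ D s)
            ∂(Measure.pi fun _ : Fin T => ρ) := by gcongr
        _ = (∫⁻ D, V (iterates step w₀ D t) ∂(Measure.pi fun _ : Fin T => ρ)
          + ∑ s ∈ Finset.range t, ∫⁻ D, e (iterates step w₀ D s)
            ∂(Measure.pi fun _ : Fin T => ρ)) + κ := by ring
        _ ≤ (V w₀ + t * κ) + κ := add_le_add_left (ih (by omega)) κ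
        _ = _ := by push_cast; ring
  exact le_add_self.trans (key T le_rfl)

end Iteration

/-! ### The averaged iterate. -/

section PathAverage

variable {m d T : ℕ} {X : Type*} {step : Weights m d → X → Weights m d} {w₀ : Weights m d}

theorem norm_pathAverage_sub_le (hT : 0 < T) {R : ℝ} (h₀ : 0 ≤ R)
    (hR : ∀ w z, ‖step w z - w₀‖ ≤ R) (D : Fin T → X) :
    ‖pathAverage step w₀ D - w₀‖ ≤ R := by
  have hmem : ∀ t, iterates step w₀ D t ∈ Metric.closedBall w₀ R := fun t =>
    iterates_mem (by simpa using h₀) (fun w z => by simpa [dist_eq_norm] using hR w z) D t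
  have hT' : (0 : ℝ) < T := by exact_mod_cast hT
  have h := (convex_closedBall w₀ R).sum_mem (t := Finset.range T) (w := fun _ => 1 / (T : ℝ))
    (z := fun t => iterates step w₀ D t) (fun t _ => by positivity)
    (by simp; field_simp) fun t _ => hmem t
  rw [← Finset.smul_sum] at h
  rwa [Metric.mem_closedBall, dist_eq_norm] at h

/-- Convexity of the square is available because the linearization is linear in the weights; the
network itself is not. -/
theorem nnLin_pathAverage_sub_sq_le (hT : 0 < T) (v : Init m d) (x : EuclideanSpace ℝ (Fin d))
    (y : ℝ) (D : Fin T → X) :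
    (nnLin v (pathAverage step w₀ D) x - y) ^ 2
      ≤ 1 / (T : ℝ) * ∑ t ∈ Finset.range T, (nnLin v (iterates step w₀ D t) x - y) ^ 2 := by
  have hT' : (0 : ℝ) < T := by exact_mod_cast hT
  have e : nnLin v (pathAverage step w₀ D) x - y
      = 1 / (T : ℝ) * ∑ t ∈ Finset.range T, (nnLin v (iterates step w₀ D t) x - y) := by
    rw [pathAverage, nnLin_eq_inner, real_inner_smul_right, inner_sum, Finset.sum_sub_distrib,
      mul_sub]
    simp only [← nnLin_eq_inner, Finset.sum_const, Finset.card_range, nsmul_eq_mul]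
    field_simp
  have hcs := sq_sum_le_card_mul_sum_sq (s := Finset.range T)
    (f := fun t => nnLin v (iterates step w₀ D t) x - y)
  rw [Finset.card_range] at hcs
  rw [e, mul_pow]
  calc (1 / (T : ℝ)) ^ 2 * (∑ t ∈ Finset.range T, (nnLin v (iterates step w₀ D t) x - y)) ^ 2
      ≤ (1 / (T : ℝ)) ^ 2 *
        (T * ∑ t ∈ Finset.range T, (nnLin v (iterates step w₀ D t) x - y) ^ 2) := by gcongr
    _ = _ := by field_simp

end PathAverage

/-! ### The policy evaluation error for a fixed history. -/

section PolicyEvaluation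

variable {S A : Type*} [MeasurableSpace S] [MeasurableSpace A] {d : ℕ}

theorem measurable_tdStep (M : MDP S A d) (γ : ℝ) (p : Params) :
    Measurable fun q : Init p.m d × Weights p.m d × Sample S A =>
      tdStep M γ p q.1 q.2.1 q.2.2 := by
  have hMf := M.measurable_feat
  have hMr := M.measurable_reward
  have h1 : Measurable fun q : Init p.m d × Weights p.m d × Sample S A =>
      nn q.1.2 q.2.1 (M.feat q.2.2.1) := measurable_nn_uncurry.comp
    (by fun_prop : Measurable fun q : Init p.m d × Weights p.m d × Sample S A =>
      ((q.1.2, q.2.1), M.feat q.2.2.1))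
  have h2 : Measurable fun q : Init p.m d × Weights p.m d × Sample S A =>
      nn q.1.2 q.2.1 (M.feat q.2.2.2.2) := measurable_nn_uncurry.comp
    (by fun_prop : Measurable fun q : Init p.m d × Weights p.m d × Sample S A =>
      ((q.1.2, q.2.1), M.feat q.2.2.2.2))
  have h3 : Measurable fun q : Init p.m d × Weights p.m d × Sample S A =>
      nnGrad q.1.2 q.2.1 (M.feat q.2.2.1) := measurable_nnGrad_uncurry.comp
    (by fun_prop : Measurable fun q : Init p.m d × Weights p.m d × Sample S A =>
      ((q.1.2, q.2.1), M.feat q.2.2.1))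
  unfold tdStep
  exact measurable_projBall _ (by fun_prop) (by fun_prop)

theorem measurable_nnLin_feat (M : MDP S A d) {m : ℕ} (v : Init m d) :
    Measurable fun q : Weights m d × (S × A) => nnLin v q.1 (M.feat q.2) := by
  have hMf := M.measurable_feat
  have h1 : Measurable fun q : Weights m d × (S × A) => ((v, q.1), M.feat q.2) := by fun_prop
  have h2 := measurable_nnLin_uncurry.comp h1
  exact h2

theorem measurable_nnLin_feat_right (M : MDP S A d) {m : ℕ} (v : Init m d) (ω : Weights m d) :
    Measurable fun x : S × A => nnLin v ω (M.feat x) := by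
  have hMf := M.measurable_feat
  simp_rw [nnLin_eq_inner, inner_nnGrad]
  refine (Finset.measurable_sum _ fun i _ => ?_).const_mul _
  refine Measurable.mul (measurable_const.mul ?_) (by fun_prop)
  exact Measurable.ite (measurableSet_lt measurable_const (by fun_prop)) measurable_const
    measurable_const

theorem measurable_uncurry_tdStep (M : MDP S A d) (γ : ℝ) (p : Params) (v : Init p.m d) :
    Measurable (Function.uncurry (tdStep M γ p v)) := by
  have h1 : Measurable fun q : Weights p.m d × Sample S A => (v, q.1, q.2) := by fun_prop
  have h2 := (measurable_tdStep M γ p).comp h1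
  exact h2

theorem measurable_iterates_tdStep (M : MDP S A d) (γ : ℝ) (p : Params) (t : ℕ) :
    Measurable fun q : Init p.m d × Batch S A p.T =>
      iterates (tdStep M γ p q.1) q.1.1 q.2 t :=
  measurable_iterates (H := Init p.m d) (step := fun v => tdStep M γ p v) (w₀ := fun v => v.1)
    (measurable_tdStep M γ p) measurable_fst t

theorem measurable_iterates_tdStep_right (M : MDP S A d) (γ : ℝ) (p : Params) (v : Init p.m d)
    (t : ℕ) : Measurable fun D : Batch S A p.T => iterates (tdStep M γ p v) v.1 D t := by
  have h1 : Measurable fun D : Batch S A p.T => (v, D) := measurable_prodMk_left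
  have h2 := (measurable_iterates_tdStep M γ p t).comp h1
  exact h2

variable {M : MDP S A d} {π : Policy S A} {γ Rmax : ℝ} {p : Params} {v : Init p.m d}
  {β : Weights p.m d} {ν : Measure S}

/-- The linearization is averaged over the path, and the network is exchanged for it only once, at
the averaged weights. That exchange is the source of the `R_Q³ m^{-1/2}` term. -/
theorem nn_tdOutput_sub_sq_le (hT : 0 < p.T) (hR : 0 ≤ p.RQ) (hfeat : ∀ x, ‖M.feat x‖ ≤ 1)
    (hb : ∀ i, |v.2 i| = 1) (D : Batch S A p.T) (x : S × A) (y : ℝ) :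
    (nn v.2 (tdOutput M γ p v D) (M.feat x) - y) ^ 2
      ≤ 2 * p.RQ ^ 2 * flipFrac v (tdOutput M γ p v D) (M.feat x)
        + 2 / (p.T : ℝ) * ∑ t ∈ Finset.range p.T,
          (nnLin v (iterates (tdStep M γ p v) v.1 D t) (M.feat x) - y) ^ 2 := by
  have h1 := nnLin_pathAverage_sub_sq_le (step := tdStep M γ p v) (w₀ := v.1) hT v (M.feat x) y D
  have h2 : ‖tdOutput M γ p v D - v.1‖ ≤ p.RQ := norm_pathAverage_sub_le hT hR
    (fun w z => norm_projBall_sub_center_le hR _) D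
  have h3 := abs_nn_sub_nnLin_le hb (tdOutput M γ p v D) (hfeat x)
  have h4 := Real.sq_sqrt (flipFrac_nonneg v (tdOutput M γ p v D) (M.feat x))
  change (nnLin v (tdOutput M γ p v D) (M.feat x) - y) ^ 2 ≤ _ at h1
  have h5 : (nn v.2 (tdOutput M γ p v D) (M.feat x) - nnLin v (tdOutput M γ p v D) (M.feat x)) ^ 2
      ≤ p.RQ ^ 2 * flipFrac v (tdOutput M γ p v D) (M.feat x) := by
    rw [← h4, ← mul_pow, ← sq_abs]
    refine pow_le_pow_left₀ (abs_nonneg _) (h3.trans ?_) 2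
    gcongr
  have h6 := add_sq_le (a := nn v.2 (tdOutput M γ p v D) (M.feat x)
    - nnLin v (tdOutput M γ p v D) (M.feat x))
    (b := nnLin v (tdOutput M γ p v D) (M.feat x) - y)
  rw [sub_add_sub_cancel] at h6
  calc _ ≤ _ := h6
    _ ≤ 2 * (p.RQ ^ 2 * flipFrac v (tdOutput M γ p v D) (M.feat x)
        + 1 / (p.T : ℝ) * ∑ t ∈ Finset.range p.T,
          (nnLin v (iterates (tdStep M γ p v) v.1 D t) (M.feat x) - y) ^ 2) := by gcongr
    _ = _ := by ring

theorem lintegral_nn_tdOutput_sub_sq_le (hT : 0 < p.T) (hR : 0 ≤ p.RQ)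
    (hfeat : ∀ x, ‖M.feat x‖ ≤ 1) (hb : ∀ i, |v.2 i| = 1) {σ : Measure (S × A)}
    [IsProbabilityMeasure σ] {y : S × A → ℝ} (hy : Measurable y) (D : Batch S A p.T) {h : ℝ}
    (hh : ∫ x, flipFrac v (tdOutput M γ p v D) (M.feat x) ∂σ ≤ h) :
    ∫⁻ x, ENNReal.ofReal ((nn v.2 (tdOutput M γ p v D) (M.feat x) - y x) ^ 2) ∂σ
      ≤ ENNReal.ofReal (2 * p.RQ ^ 2 * h) + ENNReal.ofReal (2 / p.T) *
        ∑ t ∈ Finset.range p.T, ∫⁻ x, ENNReal.ofReal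
          ((nnLin v (iterates (tdStep M γ p v) v.1 D t) (M.feat x) - y x) ^ 2) ∂σ := by
  have hfm := (measurable_flipFrac v (tdOutput M γ p v D)).comp M.measurable_feat
  have hfi : Integrable (fun x => flipFrac v (tdOutput M γ p v D) (M.feat x)) σ :=
    integrable_of_abs_le (B := 1) hfm fun x => by
      rw [abs_of_nonneg (flipFrac_nonneg _ _ _)]; exact flipFrac_le_one _ _ _
  have hlm : ∀ t, Measurable fun x : S × A => ENNReal.ofReal
      ((nnLin v (iterates (tdStep M γ p v) v.1 D t) (M.feat x) - y x) ^ 2) := fun t =>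
    (((measurable_nnLin_feat_right M v _).sub hy).pow_const 2).ennreal_ofReal
  calc _ ≤ ∫⁻ x, (ENNReal.ofReal (2 * p.RQ ^ 2 *
          flipFrac v (tdOutput M γ p v D) (M.feat x))
        + ENNReal.ofReal (2 / p.T) * ∑ t ∈ Finset.range p.T, ENNReal.ofReal
          ((nnLin v (iterates (tdStep M γ p v) v.1 D t) (M.feat x) - y x) ^ 2)) ∂σ := by
        refine lintegral_mono fun x => ?_
        have h0 := flipFrac_nonneg v (tdOutput M γ p v D) (M.feat x)
        rw [← ENNReal.ofReal_sum_of_nonneg fun _ _ => sq_nonneg _,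
          ← ENNReal.ofReal_mul (by positivity), ← ENNReal.ofReal_add (by positivity)
          (mul_nonneg (by positivity) (Finset.sum_nonneg fun _ _ => sq_nonneg _))]
        exact ENNReal.ofReal_le_ofReal (nn_tdOutput_sub_sq_le hT hR hfeat hb D x _)
    _ = ENNReal.ofReal (2 * p.RQ ^ 2 *
          ∫ x, flipFrac v (tdOutput M γ p v D) (M.feat x) ∂σ)
        + ENNReal.ofReal (2 / p.T) *
          ∑ t ∈ Finset.range p.T, ∫⁻ x, ENNReal.ofReal
          ((nnLin v (iterates (tdStep M γ p v) v.1 D t) (M.feat x) - y x) ^ 2) ∂σ := by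
        rw [lintegral_add_right _ ((Finset.measurable_sum _ fun t _ => hlm t).const_mul _),
          lintegral_const_mul _ (Finset.measurable_sum _ fun t _ => hlm t),
          lintegral_finsetSum _ fun t _ => hlm t, ← integral_const_mul,
          ofReal_integral_eq_lintegral_ofReal (hfi.const_mul _)
          (Filter.Eventually.of_forall fun x =>
            mul_nonneg (by positivity) (flipFrac_nonneg _ _ _))]
    _ ≤ _ := by gcongr

variable [Fintype A] [Nonempty A]

/-- The policy evaluation error given the history. -/
theorem lintegral_tdOutput_error_le (hγ0 : 0 < γ) (hγ1 : γ < 1)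
    (hfeat : ∀ x, ‖M.feat x‖ ≤ 1)
    (hr : ∀ x, |M.reward x| ≤ Rmax) (hb : ∀ i, |v.2 i| = 1) (hβ : ‖β - v.1‖ ≤ p.RQ)
    (hQ : ∀ x, M.Qfun γ π x = nnLin v β (M.feat x)) (hT : 0 < p.T)
    {G : ℝ} (hG : 3 * Rmax + 4 * p.RQ ≤ G)
    (hν : M.IsStationary π ν) {s h : ℝ}
    (hs : ∀ ω, ‖ω - v.1‖ ≤ p.RQ → ∫ x, √(flipFrac v ω (M.feat x)) ∂(stateAction ν π) ≤ s)
    (hh : ∀ ω, ‖ω - v.1‖ ≤ p.RQ → ∫ x, flipFrac v ω (M.feat x) ∂(stateAction ν π) ≤ h) :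
    ∫⁻ D, ∫⁻ x, ENNReal.ofReal ((nn v.2 (tdOutput M γ p v D) (M.feat x) - M.Qfun γ π x) ^ 2)
      ∂(stateAction ν π) ∂(Measure.pi fun _ : Fin p.T => sampleLaw M ν π)
      ≤ ENNReal.ofReal (2 * p.RQ ^ 2 * h + ((p.RQ ^ 2 + G ^ 2) * (p.T : ℝ) ^ (-(1 / 2) : ℝ)
        + 2 * (4 * p.RQ ^ 2 + 2 * p.RQ * G) * s) / (1 - γ)) := by
  have hR : 0 ≤ p.RQ := (norm_nonneg _).trans hβ
  have := hν.1
  have hσ : IsProbabilityMeasure (stateAction ν π) := by unfold stateAction; infer_instance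
  have hρ : IsProbabilityMeasure (sampleLaw M ν π) := isProbabilityMeasure_sampleLaw hν.1
  have hT' : (0 : ℝ) < p.T := by exact_mod_cast hT
  have h1γ : 0 < 1 - γ := by linarith
  have hη : 0 < p.stepsize := Real.rpow_pos_of_pos hT' _
  have hηT : p.stepsize * p.stepsize * p.T = 1 := by
    rw [Params.stepsize, ← Real.rpow_add hT']
    norm_num
    rw [Real.rpow_neg_one]
    field_simp
  have hv0 : ‖v.1 - v.1‖ ≤ p.RQ := by simpa using hR
  have hs0 : 0 ≤ s := (integral_nonneg fun x => Real.sqrt_nonneg _).trans (hs v.1 hv0)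
  have hh0 : 0 ≤ h := (integral_nonneg fun x => flipFrac_nonneg _ _ _).trans (hh v.1 hv0)
  have hRm : 0 ≤ Rmax := by
    obtain ⟨x⟩ : Nonempty (S × A) := nonempty_of_isProbabilityMeasure (stateAction ν π)
    exact (abs_nonneg _).trans (hr x)
  have hG0 : 0 ≤ G := by linarith
  have hMf := M.measurable_feat
  have hQm := measurable_Qfun (π := π) hγ0 hγ1 hr
  have hlin := measurable_nnLin_feat M v
  have hlinm : Measurable fun q : Weights p.m d × (S × A) =>
      ENNReal.ofReal ((nnLin v q.1 (M.feat q.2) - M.Qfun γ π q.2) ^ 2) :=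
    ((hlin.sub (hQm.comp measurable_snd)).pow_const 2).ennreal_ofReal
  set e : Weights p.m d → ℝ≥0∞ := fun ω =>
    ∫⁻ x, ENNReal.ofReal ((nnLin v ω (M.feat x) - M.Qfun γ π x) ^ 2) ∂(stateAction ν π) with he
  have hem : Measurable e := hlinm.lintegral_prod_right'
  have hstepm := measurable_uncurry_tdStep M γ p v
  have hm := measurable_iterates_tdStep_right M γ p v
  set K := 2 * p.stepsize * ((4 * p.RQ ^ 2 + 2 * p.RQ * G) * s) + p.stepsize ^ 2 * G ^ 2 with hK
  have hK0 : 0 ≤ K := by positivity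
  set a := 2 * p.stepsize * (1 - γ) with ha
  have ha0 : 0 < a := by positivity
  have htel := sum_lintegral_iterates_le (T := p.T) (ρ := sampleLaw M ν π) (step := tdStep M γ p v)
    (w₀ := v.1) hstepm (V := fun ω => ENNReal.ofReal (‖ω - β‖ ^ 2))
    (e := fun ω => ENNReal.ofReal a * e ω) (by fun_prop) (by fun_prop)
    (B := {ω | ‖ω - v.1‖ ≤ p.RQ}) hv0 (fun w z => norm_projBall_sub_center_le hR _)
    (κ := ENNReal.ofReal K) fun ω hω =>
      lintegral_norm_tdStep_sub_sq_le hγ0 hγ1 hfeat hr hb hβ hQ hω hη.le hG hν (hs ω hω)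
  have hemt : ∀ t, Measurable fun D : Batch S A p.T => e (iterates (tdStep M γ p v) v.1 D t) :=
    fun t => hem.comp (hm t)
  simp_rw [lintegral_const_mul _ (hemt _), ← Finset.mul_sum] at htel
  -- The loop starts at the centre of the ball, so the initial potential is at most `R_Q²`.
  have htel2 : ∑ t ∈ Finset.range p.T, ∫⁻ D, e (iterates (tdStep M γ p v) v.1 D t)
      ∂(Measure.pi fun _ : Fin p.T => sampleLaw M ν π)
      ≤ ENNReal.ofReal ((p.RQ ^ 2 + p.T * K) / a) := by
    rw [ENNReal.ofReal_div_of_pos ha0, ENNReal.le_div_iff_mul_le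
      (Or.inl (by simpa using ha0)) (Or.inl ENNReal.ofReal_ne_top), mul_comm]
    refine htel.trans ?_
    rw [ENNReal.ofReal_add (sq_nonneg p.RQ) (mul_nonneg hT'.le hK0), ENNReal.ofReal_mul hT'.le,
      ENNReal.ofReal_natCast]
    gcongr
    rwa [norm_sub_rev]
  have hpt : ∀ D : Batch S A p.T,
      ∫⁻ x, ENNReal.ofReal ((nn v.2 (tdOutput M γ p v D) (M.feat x) - M.Qfun γ π x) ^ 2)
        ∂(stateAction ν π) ≤ ENNReal.ofReal (2 * p.RQ ^ 2 * h)
          + ENNReal.ofReal (2 / p.T) *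
            ∑ t ∈ Finset.range p.T, e (iterates (tdStep M γ p v) v.1 D t) := fun D =>
    lintegral_nn_tdOutput_sub_sq_le hT hR hfeat hb hQm D
      (hh _ (norm_pathAverage_sub_le hT hR (fun w z => norm_projBall_sub_center_le hR _) D))
  calc _ ≤ ∫⁻ D, (ENNReal.ofReal (2 * p.RQ ^ 2 * h) + ENNReal.ofReal (2 / p.T) *
            ∑ t ∈ Finset.range p.T, e (iterates (tdStep M γ p v) v.1 D t))
          ∂(Measure.pi fun _ : Fin p.T => sampleLaw M ν π) := lintegral_mono hpt
    _ = ENNReal.ofReal (2 * p.RQ ^ 2 * h) + ENNReal.ofReal (2 / p.T) *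
          ∑ t ∈ Finset.range p.T, ∫⁻ D, e (iterates (tdStep M γ p v) v.1 D t)
            ∂(Measure.pi fun _ : Fin p.T => sampleLaw M ν π) := by
        rw [lintegral_add_left measurable_const, lintegral_const, measure_univ, mul_one,
          lintegral_const_mul _ (Finset.measurable_sum _ fun t _ => hemt t),
          lintegral_finsetSum _ fun t _ => hemt t]
    _ ≤ ENNReal.ofReal (2 * p.RQ ^ 2 * h)
          + ENNReal.ofReal (2 / p.T) * ENNReal.ofReal ((p.RQ ^ 2 + p.T * K) / a) := by gcongr
    _ = _ := by
        rw [← ENNReal.ofReal_mul (by positivity),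
          ← ENNReal.ofReal_add (by positivity) (by positivity)]
        congr 2
        rw [show (p.T : ℝ) ^ (-(1 / 2) : ℝ) = p.stepsize from rfl, hK, ha]
        -- Eliminating `T` in favour of the stepsize makes the claim a rational identity.
        have hTe : (p.T : ℝ) = 1 / (p.stepsize * p.stepsize) := by
          field_simp
          linarith
        rw [hTe]
        field_simp
        ring

end PolicyEvaluation

/-! ### Measurability of the algorithm in the history. -/

section JointMeasurability

variable {S A : Type*} [MeasurableSpace S] [MeasurableSpace A] {d m : ℕ}
  {Q : Type*} [MeasurableSpace Q]

theorem measurable_nn_comp {b : Q → Fin m → ℝ} {α : Q → Weights m d}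
    {x : Q → EuclideanSpace ℝ (Fin d)} (hb : Measurable b) (hα : Measurable α)
    (hx : Measurable x) : Measurable fun q => nn (b q) (α q) (x q) := by
  unfold nn; fun_prop

theorem measurable_nnGrad_comp {b : Q → Fin m → ℝ} {α : Q → Weights m d}
    {x : Q → EuclideanSpace ℝ (Fin d)} (hb : Measurable b) (hα : Measurable α)
    (hx : Measurable x) : Measurable fun q => nnGrad (b q) (α q) (x q) := by
  have h1 : Measurable fun q => ((b q, α q), x q) := (hb.prodMk hα).prodMk hx
  have h2 := measurable_nnGrad_uncurry.comp h1
  exact h2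

theorem measurable_pathAverage {X : Type*} [MeasurableSpace X] {T : ℕ}
    {step : Q → Weights m d → X → Weights m d} {w₀ : Q → Weights m d} {D : Q → Fin T → X}
    (hstep : Measurable fun q : Q × Weights m d × X => step q.1 q.2.1 q.2.2)
    (hw₀ : Measurable w₀) (hD : Measurable D) :
    Measurable fun q => pathAverage (step q) (w₀ q) (D q) := by
  have h : ∀ t, Measurable fun q => iterates (step q) (w₀ q) (D q) t := fun t => by
    have h1 : Measurable fun q => (q, D q) := measurable_id.prodMk hD
    have h2 := (measurable_iterates hstep hw₀ t).comp h1
    exact h2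
  unfold pathAverage
  exact (Finset.measurable_sum _ fun t _ => h t).const_smul (1 / (T : ℝ))

theorem measurable_tdOutput_comp (M : MDP S A d) (γ : ℝ) (p : Params) {v : Q → Init p.m d}
    {D : Q → Batch S A p.T} (hv : Measurable v) (hD : Measurable D) :
    Measurable fun q => tdOutput M γ p (v q) (D q) := by
  have h1 : Measurable fun q : Q × Weights p.m d × Sample S A => (v q.1, q.2) :=
    (hv.comp measurable_fst).prodMk measurable_snd
  have h2 := (measurable_tdStep M γ p).comp h1
  exact measurable_pathAverage (step := fun q => tdStep M γ p (v q)) h2 hv.fst hD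

theorem measurable_energy_uncurry (M : MDP S A d) (γ : ℝ) (p : Params) (k : ℕ) :
    Measurable fun q : Hist S A d p k × (S × A) => energy M γ p k q.1 q.2 := by
  have hMf := M.measurable_feat
  induction k with
  | zero => exact measurable_const
  | succ k ih =>
    have hD : Measurable fun h : Hist S A d p (k + 1) => h.2 (Fin.last k) := by fun_prop
    have hI : Measurable fun h : Hist S A d p (k + 1) =>
        ((h.1, Fin.init h.2) : Hist S A d p k) := by
      refine measurable_fst.prodMk (measurable_pi_lambda _ fun i => ?_)
      exact (measurable_pi_apply i.castSucc).comp measurable_snd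
    have hω := measurable_tdOutput_comp M γ p (Q := Hist S A d p (k + 1)) measurable_fst hD
    set g : Hist S A d p (k + 1) → S × A → ℝ := fun h =>
      target M p h.1 k (energy M γ p k (h.1, Fin.init h.2))
        (tdOutput M γ p h.1 (h.2 (Fin.last k))) with hg
    have hgm : Measurable fun q : Hist S A d p (k + 1) × (S × A) => g q.1 q.2 := by
      have e1 : Measurable fun q : Hist S A d p (k + 1) × (S × A) =>
          energy M γ p k (q.1.1, Fin.init q.1.2) q.2 := by
        have h1 : Measurable fun q : Hist S A d p (k + 1) × (S × A) =>
            (((q.1.1, Fin.init q.1.2) : Hist S A d p k), q.2) :=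
          (hI.comp measurable_fst).prodMk measurable_snd
        have h2 := ih.comp h1
        exact h2
      have e2 : Measurable fun q : Hist S A d p (k + 1) × (S × A) =>
          nn q.1.1.2 (tdOutput M γ p q.1.1 (q.1.2 (Fin.last k))) (M.feat q.2) :=
        measurable_nn_comp measurable_fst.fst.snd (hω.comp measurable_fst)
          (hMf.comp measurable_snd)
      simp only [hg, target]
      exact ((e2.const_mul _).add (e1.const_mul _)).const_mul _
    have hstep : Measurable fun q : Hist S A d p (k + 1) × Weights p.m d × Sample S A =>
        sgdStep M p q.1.1 (g q.1) q.2.1 q.2.2 := by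
      have hx : Measurable fun q : Hist S A d p (k + 1) × Weights p.m d × Sample S A =>
          (q.2.2.1.1, q.2.2.2.1) := by fun_prop
      have hf := hMf.comp hx
      have hα : Measurable fun q : Hist S A d p (k + 1) × Weights p.m d × Sample S A => q.2.1 :=
        measurable_snd.fst
      have hv : Measurable fun q : Hist S A d p (k + 1) × Weights p.m d × Sample S A => q.1.1 :=
        measurable_fst.fst
      have e1 := measurable_nn_comp hv.snd hα hf
      have e2 := measurable_nnGrad_comp hv.snd hα hf
      have h1 : Measurable fun q : Hist S A d p (k + 1) × Weights p.m d × Sample S A =>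
          (q.1, (q.2.2.1.1, q.2.2.2.1)) := measurable_fst.prodMk hx
      have e3 := hgm.comp h1
      unfold sgdStep
      exact measurable_projBall _ hv.fst
        (hα.sub (((e1.sub e3).const_mul _).smul e2))
    have hθ := measurable_pathAverage (Q := Hist S A d p (k + 1))
      (step := fun h => sgdStep M p h.1 (g h)) hstep measurable_fst.fst hD
    have := measurable_nn_comp (Q := Hist S A d p (k + 1) × (S × A)) measurable_fst.fst.snd
      (hθ.comp measurable_fst) (hMf.comp measurable_snd)
    exact this

variable [Fintype A] [Nonempty A]

theorem measurable_Qfun_policyAt {M : MDP S A d} {γ Rmax : ℝ} (hγ0 : 0 < γ) (hγ1 : γ < 1)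
    (hr : ∀ x, |M.reward x| ≤ Rmax) (p : Params) (k : ℕ) :
    Measurable fun q : Hist S A d p k × (S × A) => M.Qfun γ (policyAt M γ p k q.1) q.2 :=
  measurable_Qfun_energyPolicy hγ0 hγ1 hr
    (g := fun h x => (p.temp k)⁻¹ * energy M γ p k h x)
    ((measurable_energy_uncurry M γ p k).const_mul _)
    fun h => (measurable_energy M γ p k h).const_mul _

end JointMeasurability

/-! ### Averaging over the initialization. -/

section Expectation

variable {m d : ℕ}

/-- `invNormSq` is infinite at zero, so its finite expectation already excludes vanishing weights.
-/
theorem ae_init_ne_zero (hd : 3 ≤ d) : ∀ᵐ v ∂(initLaw m d), ∀ i, v.1 i ≠ 0 := by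
  have hmeas : Measurable fun v : Init m d => ∑ i, invNormSq (v.1 i) :=
    Finset.measurable_sum _ fun i _ =>
      measurable_invNormSq.comp (measurePreserving_init_fst i).measurable
  have h : ∫⁻ v, ∑ i, invNormSq (v.1 i) ∂(initLaw m d) ≠ ∞ :=
    ((lintegral_sum_invNormSq_initLaw_le hd).trans_lt
      (ENNReal.mul_lt_top (ENNReal.natCast_lt_top m) (by simp))).ne
  filter_upwards [ae_lt_top hmeas h] with v hv i hi
  have := (ENNReal.sum_lt_top.1 hv) i (Finset.mem_univ i)
  simp [invNormSq, hi] at this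

theorem lintegral_flipBound_le (hd : 3 ≤ d) (hm : 0 < m) {c R : ℝ} (hc : 0 < c) (hR : 0 < R) :
    ∫⁻ v, ENNReal.ofReal (flipBound c R v) ∂(initLaw m d) ≤ ENNReal.ofReal (2 * c * R / √m) := by
  have hm' : (0 : ℝ) < m := by exact_mod_cast hm
  have hq : 0 < √(m : ℝ) := Real.sqrt_pos.2 hm'
  have e : ∀ᵐ v ∂(initLaw m d), ENNReal.ofReal (flipBound c R v)
      = ENNReal.ofReal (c * R / (2 * √m)) +
        ENNReal.ofReal (c * R / (2 * √m) / m) * ∑ i, invNormSq (v.1 i) := by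
    filter_upwards [ae_init_ne_zero hd] with v hv
    have h1 : ∑ i, invNormSq (v.1 i) = ENNReal.ofReal (∑ i, 1 / ‖v.1 i‖ ^ 2) := by
      rw [ENNReal.ofReal_sum_of_nonneg fun i _ => by positivity]
      refine Finset.sum_congr rfl fun i _ => ?_
      have : 0 < ‖v.1 i‖ := norm_pos_iff.2 (hv i)
      rw [invNormSq, one_div, ENNReal.ofReal_inv_of_pos (by positivity)]
    rw [h1, ← ENNReal.ofReal_mul (by positivity),
      ← ENNReal.ofReal_add (by positivity) (by positivity)]
    congr 1
    rw [flipBound]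
    ring
  rw [lintegral_congr_ae e, lintegral_add_left measurable_const, lintegral_const, measure_univ,
    mul_one, lintegral_const_mul' _ _ ENNReal.ofReal_ne_top]
  -- Each inverse square norm has mean at most 3, so the constant is `(1 + 3)/2 = 2`.
  calc _ ≤ ENNReal.ofReal (c * R / (2 * √m)) +
        ENNReal.ofReal (c * R / (2 * √m) / m) * (m * 3) := by
        gcongr
        exact lintegral_sum_invNormSq_initLaw_le hd
    _ = ENNReal.ofReal (c * R / (2 * √m) + c * R / (2 * √m) / m * (m * 3)) := by
        rw [ENNReal.ofReal_add (by positivity) (by positivity),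
          ENNReal.ofReal_mul (by positivity), ENNReal.ofReal_mul (by positivity)]
        simp
    _ = _ := by
        congr 1
        field_simp
        norm_num

theorem lintegral_affine_flipBound_le (hd : 3 ≤ d) (hm : 0 < m) {c R a₀ a₁ : ℝ} (hc : 0 < c)
    (hR : 0 < R) (h₀ : 0 ≤ a₀) (h₁ : 0 ≤ a₁) :
    ∫⁻ v, ENNReal.ofReal (a₀ + a₁ * flipBound c R v) ∂(initLaw m d)
      ≤ ENNReal.ofReal (a₀ + a₁ * (2 * c * R / √m)) := by
  have e : ∀ v : Init m d, ENNReal.ofReal (a₀ + a₁ * flipBound c R v)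
      = ENNReal.ofReal a₀ + ENNReal.ofReal a₁ * ENNReal.ofReal (flipBound c R v) := fun v => by
    rw [ENNReal.ofReal_add h₀ (mul_nonneg h₁ (flipBound_nonneg hc hR v)), ENNReal.ofReal_mul h₁]
  simp_rw [e]
  rw [lintegral_add_left measurable_const, lintegral_const, measure_univ,
    mul_one, lintegral_const_mul' _ _ ENNReal.ofReal_ne_top,
    ENNReal.ofReal_add h₀ (by positivity), ENNReal.ofReal_mul h₁]
  gcongr
  exact lintegral_flipBound_le hd hm hc hR

end Expectation

/-! ### From the conditional bound to a run of the algorithm. -/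

section Run

variable {S A : Type*} [MeasurableSpace S] [MeasurableSpace A] [Fintype A] [Nonempty A]
  {d : ℕ} {M : MDP S A d} {γ Rmax : ℝ} {p : Params} {ν : Policy S A → Measure S}

theorem map_pi_sampleLaw (π : Policy S A) (hν : IsProbabilityMeasure (ν π)) (i : Fin p.T) :
    (Measure.pi fun _ : Fin p.T => sampleLaw M (ν π) π).map (fun D => (D i).1)
      = stateAction (ν π) π := by
  have := isProbabilityMeasure_sampleLaw (M := M) (π := π) hν
  have h1 : MeasurePreserving (fun D : Fin p.T → Sample S A => D i)
      (Measure.pi fun _ : Fin p.T => sampleLaw M (ν π) π) (sampleLaw M (ν π) π) :=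
    measurePreserving_eval (fun _ : Fin p.T => sampleLaw M (ν π) π) i
  exact ((measurePreserving_sampleLaw_fst (M := M) (π := π) (ν := ν π)).comp h1).map_eq

/-- A bound for the error given the history which depends on the initialization alone is a bound
in expectation. -/
theorem lintegral_run_le (hγ0 : 0 < γ) (hγ1 : γ < 1) (hr : ∀ x, |M.reward x| ≤ Rmax)
    (hν : ∀ π, M.IsStationary π (ν π)) (hT : 0 < p.T)
    {E : Set (Init p.m d)} (hE : MeasurableSet E)
    {Ω : Type*} [MeasurableSpace Ω] {μ : Measure Ω} [IsProbabilityMeasure μ]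
    {init : Ω → Init p.m d} {D : ℕ → Ω → Batch S A p.T} (hrun : IsRun M γ p ν μ init D)
    {k : ℕ} (hk : k < p.K) {B : Init p.m d → ℝ≥0∞}
    (hBm : Measurable B)
    (hB : ∀ᵐ v ∂(initLaw p.m d), v ∈ E → ∀ π : Policy S A,
      ∫⁻ D, ∫⁻ x, ENNReal.ofReal ((nn v.2 (tdOutput M γ p v D) (M.feat x) - M.Qfun γ π x) ^ 2)
        ∂(stateAction (ν π) π) ∂(Measure.pi fun _ : Fin p.T => sampleLaw M (ν π) π) ≤ B v) :
    ∫⁻ w in {w | init w ∈ E}, ∫⁻ x, ENNReal.ofReal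
        ((nn (init w).2 (tdOutput M γ p (init w) (D k w)) (M.feat x)
          - M.Qfun γ (policyAt M γ p k (history init D k w)) x) ^ 2)
        ∂(stateAction (ν (policyAt M γ p k (history init D k w)))
          (policyAt M γ p k (history init D k w))) ∂μ ≤ ∫⁻ v, B v ∂(initLaw p.m d) := by
  obtain ⟨κ, hκM, hκ, hcd⟩ := hrun.law_sample k hk
  have hX : AEMeasurable (history init D k) μ := hcd.aemeasurable_fst
  have hXp : IsProbabilityMeasure (μ.map (history init D k)) :=
    Measure.isProbabilityMeasure_map hX
  have hi : AEMeasurable init μ := hrun.law_init.aemeasurable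
  have hev : Measurable fun D : Batch S A p.T => (D ⟨0, hT⟩).1 := by fun_prop
  -- The choice `π ↦ ν π` need not be measurable. The state-action law is therefore recovered,
  -- almost surely, as the law of the first sample point under the kernel `κ`, which is measurable
  -- in the history.
  set σ : Kernel (Hist S A d p k) (S × A) := κ.map fun D => (D ⟨0, hT⟩).1 with hσ
  have hσM : IsMarkovKernel σ := Kernel.IsMarkovKernel.map _ hev
  have hσe : ∀ᵐ h ∂(μ.map (history init D k)),
      σ h = stateAction (ν (policyAt M γ p k h)) (policyAt M γ p k h) := by
    filter_upwards [hκ] with h hh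
    rw [hσ, Kernel.map_apply _ hev, hh, map_pi_sampleLaw _ (hν _).1]
  set F : Hist S A d p k × Batch S A p.T → ℝ≥0∞ := fun q =>
    ∫⁻ x, ENNReal.ofReal ((nn q.1.1.2 (tdOutput M γ p q.1.1 q.2) (M.feat x)
      - M.Qfun γ (policyAt M γ p k q.1) x) ^ 2) ∂(σ q.1) with hF
  have hFm : Measurable F := by
    have e1 := measurable_tdOutput_comp M γ p
      (Q := (Hist S A d p k × Batch S A p.T) × (S × A)) measurable_fst.fst.fst measurable_fst.snd
    have e2 := measurable_nn_comp (Q := (Hist S A d p k × Batch S A p.T) × (S × A))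
      measurable_fst.fst.fst.snd e1 (M.measurable_feat.comp measurable_snd)
    have h1 : Measurable fun q : (Hist S A d p k × Batch S A p.T) × (S × A) => (q.1.1, q.2) := by
      fun_prop
    have e3 := (measurable_Qfun_policyAt (M := M) hγ0 hγ1 hr p k).comp h1
    have e4 := ((e2.sub e3).pow_const 2).ennreal_ofReal
    exact Measurable.lintegral_kernel_prod_right' (κ := σ.comap Prod.fst measurable_fst) e4
  set G : Hist S A d p k × Batch S A p.T → ℝ≥0∞ :=
    Set.indicator {q | q.1.1 ∈ E} F with hG
  have hGm : Measurable G := hFm.indicator (measurable_fst.fst hE)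
  have hfst : (μ.map (history init D k)).map Prod.fst = initLaw p.m d := by
    rw [AEMeasurable.map_map_of_aemeasurable measurable_fst.aemeasurable hX]
    exact hrun.law_init.map_eq
  have hBae : ∀ᵐ h ∂(μ.map (history init D k)), h.1 ∈ E → ∀ π : Policy S A,
      ∫⁻ D, ∫⁻ x, ENNReal.ofReal ((nn h.1.2 (tdOutput M γ p h.1 D) (M.feat x)
        - M.Qfun γ π x) ^ 2)
        ∂(stateAction (ν π) π) ∂(Measure.pi fun _ : Fin p.T => sampleLaw M (ν π) π) ≤ B h.1 :=
    ae_of_ae_map measurable_fst.aemeasurable (by rw [hfst]; exact hB)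
  calc _ = ∫⁻ w, Set.indicator {w | init w ∈ E} (fun w => ∫⁻ x, ENNReal.ofReal
        ((nn (init w).2 (tdOutput M γ p (init w) (D k w)) (M.feat x)
          - M.Qfun γ (policyAt M γ p k (history init D k w)) x) ^ 2)
        ∂(stateAction (ν (policyAt M γ p k (history init D k w)))
          (policyAt M γ p k (history init D k w)))) w ∂μ :=
        (lintegral_indicator₀ (hi.nullMeasurableSet_preimage hE) _).symm
    _ = ∫⁻ w, G (history init D k w, D k w) ∂μ := by
        refine lintegral_congr_ae ?_
        filter_upwards [ae_of_ae_map hX hσe] with w hw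
        simp only [hG, hF, Set.indicator, Set.mem_ofPred_eq, hw]
        rfl
    _ = ∫⁻ q, G q ∂((μ.map (history init D k)) ⊗ₘ κ) := by
        rw [← hcd.map_eq, lintegral_map' hGm.aemeasurable hcd.aemeasurable]
    _ = ∫⁻ h, ∫⁻ D, G (h, D) ∂(κ h) ∂(μ.map (history init D k)) :=
        Measure.lintegral_compProd hGm
    _ ≤ ∫⁻ h, B h.1 ∂(μ.map (history init D k)) := by
        refine lintegral_mono_ae ?_
        filter_upwards [hκ, hσe, hBae] with h h1 h2 h3
        by_cases hh : h.1 ∈ E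
        -- The bound holds for all policies simultaneously, so it applies to the policy produced by
        -- the random history.
        · have := h3 hh (policyAt M γ p k h)
          simpa only [hG, hF, Set.indicator, Set.mem_ofPred_eq, hh, if_true, h1, h2] using this
        · simp [hG, hh]
    _ = _ := by rw [← hfst, lintegral_map hBm measurable_fst]

theorem measurable_flipBound {m : ℕ} (c R : ℝ) : Measurable (flipBound (m := m) (d := d) c R) := by
  unfold flipBound
  fun_prop

/-- The policy evaluation error given the initialization. -/
theorem policyEvaluation_error_le (hγ0 : 0 < γ) (hγ1 : γ < 1) {c : ℝ} (hc : 0 < c)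
    (hfeat : ∀ x, ‖M.feat x‖ ≤ 1) (hr : ∀ x, |M.reward x| ≤ Rmax)
    (hν : ∀ π, M.IsStationary π (ν π))
    (hreg : ∀ (π : Policy S A) (z : EuclideanSpace ℝ (Fin d)) (ζ : ℝ), z ≠ 0 → 0 < ζ →
      (stateAction (ν π) π).real {x | |⟪z, M.feat x⟫| ≤ ζ} ≤ c * ζ / ‖z‖)
    (hm : 0 < p.m) (hR : 0 < p.RQ) (hT : 0 < p.T) {G l : ℝ} (hG : 3 * Rmax + 4 * p.RQ ≤ G)
    (hl : 0 < l) {v : Init p.m d} (hb : ∀ i, |v.2 i| = 1) (hv : ∀ i, v.1 i ≠ 0)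
    {π : Policy S A} (hQ : M.Qfun γ π ∈ funClass M p.RQ v) :
    ∫⁻ D, ∫⁻ x, ENNReal.ofReal ((nn v.2 (tdOutput M γ p v D) (M.feat x) - M.Qfun γ π x) ^ 2)
      ∂(stateAction (ν π) π) ∂(Measure.pi fun _ : Fin p.T => sampleLaw M (ν π) π)
      ≤ ENNReal.ofReal (((p.RQ ^ 2 + G ^ 2) * (p.T : ℝ) ^ (-(1 / 2) : ℝ)
          + (4 * p.RQ ^ 2 + 2 * p.RQ * G) * l) / (1 - γ)
        + (2 * p.RQ ^ 2 + (4 * p.RQ ^ 2 + 2 * p.RQ * G) / l / (1 - γ)) *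
          flipBound c p.RQ v) := by
  obtain ⟨β, hβ, hQβ⟩ := hQ
  have := (hν π).1
  have hσ : IsProbabilityMeasure (stateAction (ν π) π) := by unfold stateAction; infer_instance
  have hh : ∀ ω, ‖ω - v.1‖ ≤ p.RQ →
      ∫ x, flipFrac v ω (M.feat x) ∂(stateAction (ν π) π) ≤ flipBound c p.RQ v := fun ω hω =>
    integral_flipFrac_le_flipBound hm M.measurable_feat hfeat hc hR (hreg π) hv hω
  refine (lintegral_tdOutput_error_le hγ0 hγ1 hfeat hr hb hβ hQβ hT hG (hν π)
    (fun ω hω => integral_sqrt_flipFrac_le M.measurable_feat hl (hh ω hω)) hh).trans_eq ?_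
  congr 1
  have : 1 - γ ≠ 0 := by linarith
  field_simp
  ring

end Run

/-! ### The final rate and the main theorem. -/

theorem rate_le {γ c Rmax R₀ R m T' : ℝ} (hγ1 : γ < 1) (hc : 0 < c) (hRmax : 0 < Rmax)
    (hR₀ : 0 < R₀) (hR : 0 < R) (hm : 0 < m) (hT' : 0 ≤ T') :
    ((R ^ 2 + ((3 * Rmax / R₀ + 4) * R) ^ 2) * T'
        + (4 * R ^ 2 + 2 * R * ((3 * Rmax / R₀ + 4) * R)) *
          (R ^ (1 / 2 : ℝ) * m ^ (-(1 / 4) : ℝ))) / (1 - γ)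
      + (2 * R ^ 2 + (4 * R ^ 2 + 2 * R * ((3 * Rmax / R₀ + 4) * R)) /
          (R ^ (1 / 2 : ℝ) * m ^ (-(1 / 4) : ℝ)) / (1 - γ)) * (2 * c * R / √m)
      ≤ ((1 + (3 * Rmax / R₀ + 4) ^ 2) / (1 - γ)
          + (4 + 2 * (3 * Rmax / R₀ + 4)) * (1 + 2 * c) / (1 - γ) + 4 * c) *
        (R ^ 2 * T' + R ^ (5 / 2 : ℝ) * m ^ (-(1 / 4) : ℝ) + R ^ 3 * m ^ (-(1 / 2) : ℝ)) := by
  have h1γ : 0 < 1 - γ := by linarith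
  set g := 3 * Rmax / R₀ + 4 with hg
  have hg0 : 0 < g := by positivity
  set a := R ^ (1 / 2 : ℝ) with ha
  set b := m ^ (-(1 / 4) : ℝ) with hb
  have ha0 : 0 < a := Real.rpow_pos_of_pos hR _
  have hb0 : 0 < b := Real.rpow_pos_of_pos hm _
  have haR : a ^ 2 = R := by
    rw [ha, ← Real.rpow_natCast, ← Real.rpow_mul hR.le]; norm_num
  have hb2 : m ^ (-(1 / 2) : ℝ) = b ^ 2 := by
    rw [hb, ← Real.rpow_natCast, ← Real.rpow_mul hm.le]; norm_num
  have hsm : √m = 1 / b ^ 2 := by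
    rw [← hb2, Real.rpow_neg hm.le, Real.sqrt_eq_rpow, one_div, one_div, inv_inv]
  have hR5 : R ^ (5 / 2 : ℝ) = R ^ 2 * a := by
    rw [ha, ← Real.rpow_natCast, ← Real.rpow_add hR]; norm_num
  rw [hb2, hsm, hR5]
  set X₁ := R ^ 2 * T' with hX₁
  set X₂ := R ^ 2 * a * b with hX₂
  set X₃ := R ^ 3 * b ^ 2 with hX₃
  -- With `l = a b = R^{1/2} m^{-1/4}`, both `l` and `(R/√m)/l` equal `a b`. Thus the two parts of
  -- the bound for `√flipFrac` merge into the factor `1 + 2c`.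
  have e : ((R ^ 2 + (g * R) ^ 2) * T' + (4 * R ^ 2 + 2 * R * (g * R)) * (a * b)) / (1 - γ)
      + (2 * R ^ 2 + (4 * R ^ 2 + 2 * R * (g * R)) / (a * b) / (1 - γ)) *
        (2 * c * R / (1 / b ^ 2))
      = (1 + g ^ 2) / (1 - γ) * X₁ + (4 + 2 * g) * (1 + 2 * c) / (1 - γ) * X₂ + 4 * c * X₃ := by
    rw [hX₁, hX₂, hX₃, ← haR]
    field_simp
    ring
  rw [e]
  have p1 : 0 ≤ (1 + g ^ 2) / (1 - γ) := by positivity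
  have p2 : 0 ≤ (4 + 2 * g) * (1 + 2 * c) / (1 - γ) := by positivity
  have p3 : 0 ≤ 4 * c := by positivity
  have x1 : 0 ≤ X₁ := by positivity
  have x2 : 0 ≤ X₂ := by positivity
  have x3 : 0 ≤ X₃ := by positivity
  generalize (1 + g ^ 2) / (1 - γ) = A₁ at p1 ⊢
  generalize (4 + 2 * g) * (1 + 2 * c) / (1 - γ) = A₂ at p2 ⊢
  generalize 4 * c = A₃ at p3 ⊢
  calc A₁ * X₁ + A₂ * X₂ + A₃ * X₃
      ≤ (A₁ + A₂ + A₃) * X₁ + (A₁ + A₂ + A₃) * X₂ + (A₁ + A₂ + A₃) * X₃ := by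
        gcongr <;> linarith
    _ = _ := by ring

end NeuralPPO

theorem mainTheorem5 (γ : ℝ) (hγ0 : 0 < γ) (hγ1 : γ < 1)
    (c : ℝ) (hc : 0 < c) (Rmax : ℝ) (hRmax : 0 < Rmax) (R₀ : ℝ) (hR₀ : 0 < R₀) :
    ∃ C : ℝ, 0 < C ∧
      ∀ (S : Type*) [MeasurableSpace S]
        (A : Type*) [Fintype A] [Nonempty A] [MeasurableSpace A] [MeasurableSingletonClass A]
        (d : ℕ) (_ : 3 ≤ d) (M : NeuralPPO.MDP S A d)
        (_ : ∀ x, ‖M.feat x‖ ≤ 1)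
        -- bounded reward
        (_ : ∀ x, |M.reward x| ≤ Rmax)
        -- stationary state distributions
        (ν : NeuralPPO.Policy S A → Measure S)
        (_ : ∀ π, M.IsStationary π (ν π))
        -- regularity of the stationary state-action distributions
        (_ : ∀ (π : NeuralPPO.Policy S A) (z : EuclideanSpace ℝ (Fin d)) (ζ : ℝ),
          z ≠ 0 → 0 < ζ →
          (NeuralPPO.stateAction (ν π) π).real {x | |⟪z, M.feat x⟫| ≤ ζ} ≤ c * ζ / ‖z‖)
        (p : NeuralPPO.Params) (_ : 0 < p.m) (_ : 0 < p.β)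
        (_ : R₀ ≤ p.RQ) (_ : p.RQ ≤ p.Rf) (_ : 64 / (1 - γ) ^ 2 ≤ (p.T : ℝ))
        -- an event of the initialization on which every action-value function is in the class
        (E : Set (NeuralPPO.Init p.m d)) (_ : MeasurableSet E)
        (_ : ∀ᵐ v ∂(NeuralPPO.initLaw p.m d), v ∈ E →
          ∀ π : NeuralPPO.Policy S A, M.Qfun γ π ∈ NeuralPPO.funClass M p.RQ v)
        -- a run of neural PPO
        (Ω : Type*) [MeasurableSpace Ω] (μ : Measure Ω) [IsProbabilityMeasure μ]
        (init : Ω → NeuralPPO.Init p.m d) (D : ℕ → Ω → NeuralPPO.Batch S A p.T)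
        (_ : NeuralPPO.IsRun M γ p ν μ init D)
        (k : ℕ) (_ : k < p.K),
        ∫⁻ w in {w | init w ∈ E},
          ∫⁻ x, ENNReal.ofReal
              ((NeuralPPO.nn (init w).2 (NeuralPPO.tdOutput M γ p (init w) (D k w)) (M.feat x)
                - M.Qfun γ
                    (NeuralPPO.policyAt M γ p k (NeuralPPO.history init D k w)) x) ^ 2)
            ∂(NeuralPPO.stateAction
                (ν (NeuralPPO.policyAt M γ p k (NeuralPPO.history init D k w)))
                (NeuralPPO.policyAt M γ p k (NeuralPPO.history init D k w))) ∂μ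
          ≤ ENNReal.ofReal
              (C * (p.RQ ^ 2 * (p.T : ℝ) ^ (-(1 / 2) : ℝ)
                + p.RQ ^ (5 / 2 : ℝ) * (p.m : ℝ) ^ (-(1 / 4) : ℝ)
                + p.RQ ^ 3 * (p.m : ℝ) ^ (-(1 / 2) : ℝ))) := by
  have h1γ : 0 < 1 - γ := by linarith
  refine ⟨(1 + (3 * Rmax / R₀ + 4) ^ 2) / (1 - γ)
    + (4 + 2 * (3 * Rmax / R₀ + 4)) * (1 + 2 * c) / (1 - γ) + 4 * c, by positivity, ?_⟩
  intro S _ A _ _ _ _ d hd M hfeat hr ν hν hreg p hm _ hRQ _ hT E hE hQ Ω _ μ _ init D hrun k hk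
  have hR : 0 < p.RQ := hR₀.trans_le hRQ
  have hm' : (0 : ℝ) < p.m := by exact_mod_cast hm
  have hT0 : (0 : ℝ) < p.T := lt_of_lt_of_le (by positivity) hT
  have hTpos : 0 < p.T := by exact_mod_cast hT0
  -- The TD error is at most `3 Rmax + 4 R_Q`. The lower bound `R₀` on `R_Q` makes this proportional
  -- to `R_Q`, so the final bound has no separate reward term.
  set G := (3 * Rmax / R₀ + 4) * p.RQ with hG
  set l := p.RQ ^ (1 / 2 : ℝ) * (p.m : ℝ) ^ (-(1 / 4) : ℝ) with hl
  have hl0 : 0 < l := by positivity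
  have hG0 : 0 < G := by positivity
  have hGle : 3 * Rmax + 4 * p.RQ ≤ G := by
    have h1 : 3 * Rmax ≤ 3 * Rmax / R₀ * p.RQ := by
      rw [div_mul_eq_mul_div, le_div_iff₀ hR₀]
      gcongr
    rw [hG, add_mul]
    linarith
  refine (NeuralPPO.lintegral_run_le hγ0 hγ1 hr hν hTpos hE hrun hk
    (B := fun v => ENNReal.ofReal (((p.RQ ^ 2 + G ^ 2) * (p.T : ℝ) ^ (-(1 / 2) : ℝ)
          + (4 * p.RQ ^ 2 + 2 * p.RQ * G) * l) / (1 - γ)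
        + (2 * p.RQ ^ 2 + (4 * p.RQ ^ 2 + 2 * p.RQ * G) / l / (1 - γ)) *
          NeuralPPO.flipBound c p.RQ v))
    (((NeuralPPO.measurable_flipBound c p.RQ).const_mul _).const_add _).ennreal_ofReal ?_).trans ?_
  · filter_upwards [hQ, NeuralPPO.ae_abs_sign_eq_one, NeuralPPO.ae_init_ne_zero hd]
      with v h1 h2 h3 h4 π
    exact NeuralPPO.policyEvaluation_error_le hγ0 hγ1 hc hfeat hr hν hreg hm hR hTpos hGle hl0
      h2 h3 (h1 h4 π)
  · refine (NeuralPPO.lintegral_affine_flipBound_le hd hm hc hR (by positivity)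
      (by positivity)).trans (ENNReal.ofReal_le_ofReal ?_)
    exact NeuralPPO.rate_le hγ1 hc hRmax hR₀ hR hm' (by positivity)
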